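/- **Setting.** A seller faces buyers $1,\dots,n$ with independent values $v_i\sim F_i$, where each $F_i$ is a probability distribution on $[0,\infty)$ (atoms allowed, the $F_i$ may differ). A nonempty downward-closed family $\mathcal X\subseteq 2^{[n]}$ of feasible buyer sets is given, and an allocation $x\in[0,1]^n$ is feasible if it is a convex combination of indicator vectors of sets in $\mathcal X$. The distribution $F$ is *quasi-MHR* if $v\mapsto \frac{-\ln(1-F(v))}{v}$ is weakly increasing on $v>0$ (with value $+\infty$ where $F(v)=1$). A *monopoly reserve* of $F$ is a price $r\ge 0$ that maximizes $p\cdot\Pr_{v\sim F}[v\ge p]$ over $p\ge 0$. The *optimal revenue* $\mathrm{OPT}$ is the supremum of the expected total payment over all feasible, Bayesian incentive compatible and interim individually rational mechanisms with nonnegative payments. The *optimal welfare* is $\mathrm{WEL}=\mathbb E\big[\max_{S\in\mathcal X}\sum_{i\in S}v_i\big]$. VCG serves a set $S\in\mathcal X$ that maximizes $\sum_{i\in S}v_i$ (ties broken by any fixed measurable rule), and the VCG payment of a winner is the externality that he imposes on the others. Let $r_i$ be a monopoly reserve of $F_i$. * *Eager monopoly reserves*: remove all buyers with $v_i<r_i$,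 run VCG on the remaining buyers, and charge each winner $i$ the larger of $r_i$ and his VCG payment. * *Lazy monopoly reserves*: run VCG on all buyers, remove the winners with $v_i<r_i$, and charge each remaining winner $i$ the larger of $r_i$ and his VCG payment. Write $\mathrm{Rev}_{\rm eager}$ and $\mathrm{Rev}_{\rm lazy}$ for the expected revenues. **Theorem.** (i) For every $n$, every downward-closed $\mathcal X$, all quasi-MHR distributions $F_1,\dots,F_n$, every choice of monopoly reserves and every tie-breaking rule, $$\mathrm{Rev}_{\rm eager}\ \ge\ \tfrac1{e+1}\,\mathrm{OPT},\qquad \mathrm{Rev}_{\rm lazy}\ \ge\ \tfrac1{e+1}\,\mathrm{OPT},\qquad \mathrm{Rev}_{\rm lazy}\ \ge\ \tfrac1{e+1}\,\mathrm{WEL}.$$ (ii) The constant $\frac1{e+1}$ is best possible in all three inequalities: for every $\varepsilon>0$ there are a downward-closed setting and quasi-MHR buyers, each with a unique monopoly reserve, such that $\mathrm{OPT}>0$, $\mathrm{WEL}<\infty$ and, for every tie-breaking rule, $$\mathrm{Rev}_{\rm eager}\le\big(\tfrac1{e+1}+\varepsilon\big)\mathrm{OPT},\qquad \mathrm{Rev}_{\rm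 lazy}\le\big(\tfrac1{e+1}+\varepsilon\big)\mathrm{OPT},\qquad \mathrm{Rev}_{\rm lazy}\le\big(\tfrac1{e+1}+\varepsilon\big)\mathrm{WEL}.$$ -/

import Mathlib

open MeasureTheory ProbabilityTheory

noncomputable section

namespace MonopolyReserves

/-! ### Valuation distributions -/

/-- A distribution on `[0, ∞)` (atoms allowed) is quasi-MHR if its conditional expected hazard rate
`v ↦ -ln (1 - F v) / v` is weakly increasing on `v > 0`. At values with `F v = 1` the rate is `+∞`,
so that nothing is required there. -/
structure IsQuasiMHR (μ : Measure ℝ) : Prop where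
  nonneg : ∀ᵐ v ∂μ, 0 ≤ v
  mono : MonotoneOn (fun v : ℝ => -Real.log (1 - cdf μ v) / v) {v : ℝ | 0 < v ∧ cdf μ v < 1}

/-- A monopoly reserve: a price `r ≥ 0` that maximizes the revenue `p * Pr[v ≥ p]` of posting a
price to a single buyer. -/
def IsMonopolyReserve (μ : Measure ℝ) (r : ℝ) : Prop :=
  0 ≤ r ∧ ∀ p : ℝ, 0 ≤ p → p * μ.real (Set.Ici p) ≤ r * μ.real (Set.Ici r)

/-! ### Downward-closed settings, direct mechanisms, optimal revenue -/

/-- A nonempty downward-closed system of feasible sets of buyers. -/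
def IsDownwardClosed {ι : Type*} (X : Finset (Finset ι)) : Prop :=
  X.Nonempty ∧ ∀ S ∈ X, ∀ T, T ⊆ S → T ∈ X

theorem IsDownwardClosed.empty_mem {ι : Type*} {X : Finset (Finset ι)} (hX : IsDownwardClosed X) :
    ∅ ∈ X := by
  obtain ⟨S, hS⟩ := hX.1
  exact hX.2 S hS ∅ (Finset.empty_subset S)

variable {ι : Type*} [Fintype ι] [DecidableEq ι]

/-- The feasible (randomized) allocations: convex combinations of indicator vectors of feasible
sets. -/
def feasibleAllocations (X : Finset (Finset ι)) : Set (ι → ℝ) :=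
  convexHull ℝ ((fun (S : Finset ι) (i : ι) => if i ∈ S then (1 : ℝ) else 0) '' (X : Set (Finset ι)))

/-- A direct mechanism maps each profile of reported values to allocations and payments. -/
structure Mechanism (ι : Type*) where
  alloc : (ι → ℝ) → ι → ℝ
  pay : (ι → ℝ) → ι → ℝ

/-- Expected utility of buyer `i` with value `t` who reports `b`, the others being truthful. -/
def Mechanism.interimUtility (M : Mechanism ι) (μ : ι → Measure ℝ) (i : ι) (t b : ℝ) : ℝ :=
  ∫ v, (t * M.alloc (Function.update v i b) i - M.pay (Function.update v i b) i) ∂(Measure.pi μ)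

/-- `M` is feasible, has nonnegative payments, and is Bayesian incentive compatible and interim
individually rational; values and reports of buyer `i` range over the support of `μ i`. -/
structure Mechanism.IsAdmissible (M : Mechanism ι) (X : Finset (Finset ι)) (μ : ι → Measure ℝ) :
    Prop where
  measurable_alloc : Measurable M.alloc
  measurable_pay : Measurable M.pay
  feasible : ∀ v, M.alloc v ∈ feasibleAllocations X
  pay_nonneg : ∀ v i, 0 ≤ M.pay v i
  integrable_pay : ∀ i, ∀ b ∈ (μ i).support,
    Integrable (fun v => M.pay (Function.update v i b) i) (Measure.pi μ)
  incentive_compatible : ∀ i, ∀ t ∈ (μ i).support, ∀ b ∈ (μ i).support,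
    M.interimUtility μ i t b ≤ M.interimUtility μ i t t
  individually_rational : ∀ i, ∀ t ∈ (μ i).support, 0 ≤ M.interimUtility μ i t t

/-- Expected total payment under truthful reports. -/
def Mechanism.revenue (M : Mechanism ι) (μ : ι → Measure ℝ) : ENNReal :=
  ∫⁻ v, ∑ i, ENNReal.ofReal (M.pay v i) ∂(Measure.pi μ)

/-- The revenue of the Bayesian optimal mechanism. -/
def optimalRevenue (X : Finset (Finset ι)) (μ : ι → Measure ℝ) : ENNReal :=
  ⨆ M : Mechanism ι, ⨆ _ : M.IsAdmissible X μ, M.revenue μ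

/-! ### Welfare and VCG -/

/-- The welfare of serving the set `S`. -/
def welfare (v : ι → ℝ) (S : Finset ι) : ℝ := ∑ i ∈ S, v i

/-- The largest welfare of a set in the (nonempty finite) family `X`. -/
def maxWelfare (X : Finset (Finset ι)) (v : ι → ℝ) : ℝ :=
  sSup (welfare v '' (X : Set (Finset ι)))

/-- The optimal expected welfare (first best). -/
def optimalWelfare (X : Finset (Finset ι)) (μ : ι → Measure ℝ) : ENNReal :=
  ∫⁻ v, ENNReal.ofReal (maxWelfare X v) ∂(Measure.pi μ)

/-- `w` picks, measurably in the profile `v`, a welfare-maximizing set of the family `Y v`, with an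
arbitrary rule for breaking ties. -/
structure IsWinnerRule (Y : (ι → ℝ) → Finset (Finset ι)) (w : (ι → ℝ) → Finset ι) : Prop where
  measurable : ∀ S, MeasurableSet {v | w v = S}
  mem : ∀ v, w v ∈ Y v
  optimal : ∀ v, ∀ S ∈ Y v, welfare v S ≤ welfare v (w v)

/-- The VCG payment of a winner `i` when `W` is served and `X` is the family of feasible sets: the
externality that `i` imposes on the others. -/
def vcgPayment (X : Finset (Finset ι)) (v : ι → ℝ) (W : Finset ι) (i : ι) : ℝ :=
  maxWelfare (X.filter (fun S => i ∉ S)) v - welfare v (W.erase i)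

/-- The feasible sets all of whose members meet their reserves. -/
def eagerFamily (X : Finset (Finset ι)) (r : ι → ℝ) (v : ι → ℝ) : Finset (Finset ι) :=
  X.filter (fun S => ∀ i ∈ S, r i ≤ v i)

/-- Winner rules of VCG after removing all buyers whose value is below their reserve. -/
def IsEagerRule (X : Finset (Finset ι)) (r : ι → ℝ) (w : (ι → ℝ) → Finset ι) : Prop :=
  IsWinnerRule (eagerFamily X r) w

/-- Winner rules of VCG with all buyers, as used for lazy reserves. -/
def IsLazyRule (X : Finset (Finset ι)) (w : (ι → ℝ) → Finset ι) : Prop :=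
  IsWinnerRule (fun _ => X) w

/-- Winner rules exist, whatever (measurably varying) family containing `∅` is used. -/
theorem exists_isWinnerRule (Y : (ι → ℝ) → Finset (Finset ι)) (h0 : ∀ v, ∅ ∈ Y v)
    (hY : ∀ S, MeasurableSet {v | S ∈ Y v}) : ∃ w, IsWinnerRule Y w := by
  suffices h : ∀ s : Finset (Finset ι), ∃ w : (ι → ℝ) → Finset ι,
      (∀ S, MeasurableSet {v | w v = S}) ∧ (∀ v, w v ∈ Y v) ∧
        ∀ v, ∀ S ∈ s, S ∈ Y v → welfare v S ≤ welfare v (w v) by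
    obtain ⟨w, h1, h2, h3⟩ := h Finset.univ
    exact ⟨w, h1, h2, fun v S hS => h3 v S (Finset.mem_univ S) hS⟩
  have hm : ∀ S : Finset ι, Measurable (fun v : ι → ℝ => welfare v S) := fun S => by
    unfold welfare
    fun_prop
  intro s
  induction s using Finset.induction_on with
  | empty => exact ⟨fun _ => ∅, fun S => by simp, h0, by simp⟩
  | insert a s _ ih =>
    obtain ⟨w, h1, h2, h3⟩ := ih
    have hc : MeasurableSet {v | a ∈ Y v ∧ welfare v (w v) < welfare v a} := by
      have : {v | a ∈ Y v ∧ welfare v (w v) < welfare v a} =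
          {v | a ∈ Y v} ∩ ⋃ S, ({v | w v = S} ∩ {v | welfare v S < welfare v a}) := by
        ext v
        simp
      rw [this]
      exact (hY a).inter (MeasurableSet.iUnion fun S =>
        (h1 S).inter (measurableSet_lt (hm S) (hm a)))
    refine ⟨fun v => if a ∈ Y v ∧ welfare v (w v) < welfare v a then a else w v, ?_, ?_, ?_⟩
    · intro S
      have : {v | (if a ∈ Y v ∧ welfare v (w v) < welfare v a then a else w v) = S} =
          ({v | a ∈ Y v ∧ welfare v (w v) < welfare v a} ∩ {_v | a = S}) ∪
            ({v | a ∈ Y v ∧ welfare v (w v) < welfare v a}ᶜ ∩ {v | w v = S}) := by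
        ext v
        by_cases h : a ∈ Y v ∧ welfare v (w v) < welfare v a
        · simp [h]
        · simp only [Set.mem_ofPred_eq, h, if_false, Set.mem_union, Set.mem_inter_iff,
            Set.mem_compl_iff]
          simp
      rw [this]
      exact (hc.inter (MeasurableSet.const _)).union (hc.compl.inter (h1 S))
    · intro v
      dsimp only
      split_ifs with h
      · exact h.1
      · exact h2 v
    · intro v S hS hSY
      dsimp only
      rcases Finset.mem_insert.1 hS with rfl | hS
      · split_ifs with h
        · exact le_rfl
        · exact not_lt.1 fun h' => h ⟨hSY, h'⟩
      · split_ifs with h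
        · exact (h3 v S hS hSY).trans h.2.le
        · exact h3 v S hS hSY

theorem exists_isLazyRule (X : Finset (Finset ι)) (hX : IsDownwardClosed X) :
    ∃ w, IsLazyRule X w :=
  exists_isWinnerRule _ (fun _ => hX.empty_mem) fun _ => MeasurableSet.const _

theorem exists_isEagerRule (X : Finset (Finset ι)) (hX : IsDownwardClosed X) (r : ι → ℝ) :
    ∃ w, IsEagerRule X r w := by
  refine exists_isWinnerRule _ (fun v => by simp [eagerFamily, hX.empty_mem]) fun S => ?_
  have : {v : ι → ℝ | S ∈ eagerFamily X r v} =
      {_v | S ∈ X} ∩ ⋂ i ∈ S, {v | r i ≤ v i} := by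
    ext v
    simp [eagerFamily]
  rw [this]
  exact (MeasurableSet.const _).inter (Finset.measurableSet_biInter S fun i _ =>
    measurableSet_le measurable_const (measurable_pi_apply i))

/-- Expected revenue of VCG with eager reserves `r`: buyers below their reserve are removed, VCG is
run on the others, and each winner pays the larger of the reserve and the VCG payment. -/
def eagerRevenue (X : Finset (Finset ι)) (μ : ι → Measure ℝ) (r : ι → ℝ)
    (w : (ι → ℝ) → Finset ι) : ENNReal :=
  ∫⁻ v, ∑ i ∈ w v, ENNReal.ofReal (max (r i) (vcgPayment (eagerFamily X r v) v (w v) i))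
    ∂(Measure.pi μ)

/-- Expected revenue of VCG with lazy reserves `r`: VCG is run on all buyers, winners below their
reserve are removed, and each remaining winner pays the larger of the reserve and the VCG
payment. -/
def lazyRevenue (X : Finset (Finset ι)) (μ : ι → Measure ℝ) (r : ι → ℝ)
    (w : (ι → ℝ) → Finset ι) : ENNReal :=
  ∫⁻ v, ∑ i ∈ (w v).filter (fun i => r i ≤ v i),
    ENNReal.ofReal (max (r i) (vcgPayment X v (w v) i)) ∂(Measure.pi μ)

end MonopolyReserves

end

open MeasureTheory ProbabilityTheory

noncomputable section

namespace MonopolyReserves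

set_option linter.unusedSectionVars false

/-! ### A single quasi-MHR buyer -/

section SingleBuyer

/-! Lower bounds. Fix a buyer with monopoly revenue `R` and put `K = e * R`. Optimality of the
reserve gives `Pr[v > K] ≤ 1 / e`, so by quasi-MHR the tail is at most `exp (-s / K)` for `s ≥ K`,
and the mean is at most `K + K / e = (e + 1) * R` (`IsQuasiMHR.lintegral_le`). Interpolating between
this envelope and the exponential decay beyond a price `t ≥ r` gives the conditional version `E[v; v
> t] ≤ (e + 1) * t * Pr[v > t]` (`IsQuasiMHR.lintegral_Ioi_le`).

In VCG, with the other values fixed, a buyer who can win faces a threshold price equal to his VCG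
payment (`IsWinnerRule.exists_threshold`). The single-buyer bounds compare his welfare when winning
with the payment `max r t`; integrating over the others and summing over buyers shows that the
welfare of the VCG winners is at most `e + 1` times the revenue
(`IsWinnerRule.lintegral_welfare_le`). For lazy reserves this welfare is the first best, which also
bounds the optimal revenue.

For eager reserves it remains to bound the optimal revenue by the welfare of eager VCG. This needs
no regularity: for every value distribution with a monopoly reserve `r`, an incentive compatible
menu earns at most the welfare that it generates on types `≥ r` (`IsMenu.lintegral_pay_le`). Below
`r` the distribution is dominated by an equal-revenue one, against which the payments integrate to
at most the utility of type `r` times `Pr[v ≥ r]`, and every type `≥ r` keeps at least that utility.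
Feasibility, profile by profile, then gives `optimalRevenue_le_lintegral_welfare`.

Tightness. A buyer of known value `b` competes with a `k`-unit auction among `N` small buyers whose
values are exponential of rate slightly above `1 / e`, truncated to `[1, M]`. With `k` slightly
above the number of values exceeding `1`, and `b` slightly below their sum, the small buyers
typically win at price `1`. The revenue is about `N * q` with `q = Pr[v > 1]`, whereas selling to
the large buyer earns `b`, about `(e + 1) * N * q` (`exists_rival_tight`). -/

theorem lintegral_exp_neg_mul_Ioi {c : ℝ} (hc : 0 < c) (a : ℝ) :
    ∫⁻ s in Set.Ioi a, ENNReal.ofReal (Real.exp (-(c * s))) =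
      ENNReal.ofReal (Real.exp (-(c * a)) / c) := by
  have h1 : IntegrableOn (fun s => Real.exp (-c * s)) (Set.Ioi a) :=
    integrableOn_exp_mul_Ioi (neg_neg_of_pos hc) a
  have h2 : ∫ s in Set.Ioi a, Real.exp (-c * s) = Real.exp (-(c * a)) / c := by
    rw [integral_exp_mul_Ioi (neg_neg_of_pos hc) a, neg_mul, neg_div_neg_eq]
  rw [← h2, ofReal_integral_eq_lintegral_ofReal h1 (ae_of_all _ fun s => (Real.exp_pos _).le)]
  simp only [neg_mul]

theorem one_sub_cdf (μ : Measure ℝ) [IsProbabilityMeasure μ] (s : ℝ) :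
    1 - cdf μ s = μ.real (Set.Ioi s) := by
  rw [cdf_eq_real, ← Set.compl_Iic, probReal_compl_eq_one_sub measurableSet_Iic]

/-- The power bound on the tail of a quasi-MHR distribution. -/
theorem IsQuasiMHR.tail_le_exp {μ : Measure ℝ} [IsProbabilityMeasure μ] (hμ : IsQuasiMHR μ)
    {s t a : ℝ} (ht : 0 < t) (hts : t ≤ s) (ha : μ.real (Set.Ioi t) ≤ Real.exp (-(a * t))) :
    μ.real (Set.Ioi s) ≤ Real.exp (-(a * s)) := by
  rcases (measureReal_nonneg : 0 ≤ μ.real (Set.Ioi s)).eq_or_lt with h0 | h0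
  · rw [← h0]; positivity
  have hs : 0 < s := ht.trans_le hts
  have hmono : μ.real (Set.Ioi s) ≤ μ.real (Set.Ioi t) :=
    measureReal_mono (Set.Ioi_subset_Ioi hts)
  have h1 : cdf μ s < 1 := by have := one_sub_cdf μ s; linarith
  have h2 : cdf μ t < 1 := by have := one_sub_cdf μ t; linarith
  have h := hμ.mono (a := t) ⟨ht, h2⟩ (b := s) ⟨hs, h1⟩ hts
  simp only [one_sub_cdf] at h
  rw [div_le_div_iff₀ ht hs] at h
  have h3 : Real.log (μ.real (Set.Ioi t)) ≤ -(a * t) :=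
    (Real.log_le_iff_le_exp (h0.trans_le hmono)).2 ha
  rw [← Real.log_le_iff_le_exp h0]
  have h4 : (a * t) * s ≤ -Real.log (μ.real (Set.Ioi s)) * t := by nlinarith
  have h5 : (a * s) * t ≤ -Real.log (μ.real (Set.Ioi s)) * t := by linarith
  linarith [le_of_mul_le_mul_right h5 ht]

theorem IsMonopolyReserve.revenue_nonneg {μ : Measure ℝ} {r : ℝ} (hr : IsMonopolyReserve μ r) :
    0 ≤ r * μ.real (Set.Ici r) := mul_nonneg hr.1 measureReal_nonneg

variable {μ : Measure ℝ} [IsProbabilityMeasure μ] {r : ℝ}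

theorem IsMonopolyReserve.mul_tail_le (hr : IsMonopolyReserve μ r) {p : ℝ} (hp : 0 ≤ p) :
    p * μ.real (Set.Ioi p) ≤ r * μ.real (Set.Ici r) :=
  (mul_le_mul_of_nonneg_left (measureReal_mono Set.Ioi_subset_Ici_self) hp).trans (hr.2 p hp)

theorem IsMonopolyReserve.revenue_le (hr : IsMonopolyReserve μ r) :
    r * μ.real (Set.Ici r) ≤ r := mul_le_of_le_one_right hr.1 measureReal_le_one

/-- This settles the degenerate case in which `K = e * R` vanishes and cannot serve as a scale: no
positive price sells with positive probability. -/
theorem IsMonopolyReserve.tail_eq_zero (hr : IsMonopolyReserve μ r)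
    (h0 : r * μ.real (Set.Ici r) = 0) {t : ℝ} (ht : 0 ≤ t) : μ (Set.Ioi t) = 0 := by
  have h : ∀ s : ℝ, 0 < s → μ (Set.Ici s) = 0 := fun s hs => by
    have := hr.2 s hs.le
    rw [h0] at this
    have h2 : μ.real (Set.Ici s) ≤ 0 := by
      by_contra hc
      push Not at hc
      nlinarith [mul_pos hs hc]
    exact (measureReal_eq_zero_iff (measure_ne_top _ _)).1 (h2.antisymm measureReal_nonneg)
  have : Set.Ioi t = ⋃ n : ℕ, Set.Ici (t + 1 / ((n : ℝ) + 1)) := by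
    ext x
    simp only [Set.mem_Ioi, Set.mem_iUnion, Set.mem_Ici]
    constructor
    · intro hx
      obtain ⟨n, hn⟩ := exists_nat_one_div_lt (sub_pos.2 hx)
      exact ⟨n, by linarith⟩
    · rintro ⟨n, hn⟩
      have : (0 : ℝ) < 1 / ((n : ℝ) + 1) := by positivity
      linarith
  rw [this, measure_iUnion_null_iff]
  intro n
  exact h _ (by positivity)

/-- Beyond `e` times the monopoly revenue, the tail is at most exponential. -/
theorem IsQuasiMHR.tail_le_exp_revenue (hμ : IsQuasiMHR μ) (hr : IsMonopolyReserve μ r)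
    {R : ℝ} (hR : R = r * μ.real (Set.Ici r)) (hR0 : 0 < R) {s : ℝ} (hs : Real.exp 1 * R ≤ s) :
    μ.real (Set.Ioi s) ≤ Real.exp (-(1 / (Real.exp 1 * R) * s)) := by
  have hK : 0 < Real.exp 1 * R := by positivity
  -- It suffices to look at the price `K = e * R`: it earns at most `R`, so it sells with
  -- probability at most `1 / e = exp (-K / K)`.
  refine hμ.tail_le_exp hK hs ?_
  have h := hr.mul_tail_le hK.le
  rw [← hR] at h
  rw [one_div, inv_mul_cancel₀ hK.ne', Real.exp_neg, ← one_div, le_div_iff₀ (Real.exp_pos 1)]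
  have h2 : R * (μ.real (Set.Ioi (Real.exp 1 * R)) * Real.exp 1) ≤ R * 1 := by linarith
  exact le_of_mul_le_mul_left h2 hR0

/-- The integral of the bound `1` on `(0, K - t)` and `exp (-(s + t) / K)` beyond. -/
theorem lintegral_tail_envelope {K t : ℝ} (hK : 0 < K) (ht : t ≤ K) :
    ∫⁻ s in Set.Ioi 0, ENNReal.ofReal (if s < K - t then 1 else Real.exp (-(1 / K * (t + s)))) ≤
      ENNReal.ofReal (K - t + K * Real.exp (-1)) := by
  have hsplit : Set.Ioi (0 : ℝ) ⊆ Set.Ioc 0 (K - t) ∪ Set.Ioi (K - t) := fun x hx => by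
    rcases le_or_gt x (K - t) with h | h
    · exact Or.inl ⟨hx, h⟩
    · exact Or.inr h
  have hKt : 0 ≤ K - t := by linarith
  calc _ ≤ _ := lintegral_mono_set hsplit
    _ ≤ _ := lintegral_union_le _ _ _
    _ ≤ ENNReal.ofReal (K - t) + ENNReal.ofReal (K * Real.exp (-1)) := ?_
    _ = _ := (ENNReal.ofReal_add hKt (by positivity)).symm
  refine add_le_add ?_ ?_
  · calc _ ≤ ∫⁻ s in Set.Ioc 0 (K - t), 1 := by
          refine setLIntegral_mono_ae' measurableSet_Ioc (ae_of_all _ fun s hs => ?_)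
          rw [← ENNReal.ofReal_one]
          refine ENNReal.ofReal_le_ofReal ?_
          split_ifs with h
          · exact le_rfl
          · rw [Real.exp_le_one_iff, neg_nonpos]
            have : 0 ≤ t + s := by
              push Not at h
              linarith
            positivity
      _ = _ := by simp
  · calc _ = ∫⁻ s in Set.Ioi (K - t), ENNReal.ofReal (Real.exp (-(1 / K * t))) *
            ENNReal.ofReal (Real.exp (-(1 / K * s))) := by
          refine setLIntegral_congr_fun measurableSet_Ioi fun s hs => ?_
          have : ¬ s < K - t := not_lt.2 (le_of_lt hs)
          simp only [this, if_false]
          rw [← ENNReal.ofReal_mul (Real.exp_pos _).le, ← Real.exp_add]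
          ring_nf
      _ = _ := by
          rw [lintegral_const_mul _ (by fun_prop), lintegral_exp_neg_mul_Ioi (by positivity),
            ← ENNReal.ofReal_mul (Real.exp_pos _).le, mul_div_assoc', ← Real.exp_add]
          congr 1
          rw [div_div_eq_mul_div, div_one, mul_comm]
          congr 2
          field_simp
          ring
      _ ≤ _ := le_rfl

/-- The expected value is at most `e + 1` times the monopoly revenue. -/
theorem IsQuasiMHR.lintegral_le (hμ : IsQuasiMHR μ) (hr : IsMonopolyReserve μ r) :
    ∫⁻ v, ENNReal.ofReal v ∂μ ≤
      ENNReal.ofReal ((Real.exp 1 + 1) * (r * μ.real (Set.Ici r))) := by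
  rw [lintegral_eq_lintegral_meas_lt μ hμ.nonneg aemeasurable_id]
  rcases hr.revenue_nonneg.eq_or_lt with h0 | h0
  · rw [← h0]
    simp only [mul_zero, ENNReal.ofReal_zero, nonpos_iff_eq_zero]
    exact (setLIntegral_congr_fun measurableSet_Ioi fun s hs =>
      hr.tail_eq_zero h0.symm (le_of_lt hs)).trans (by simp)
  · set R := r * μ.real (Set.Ici r) with hR
    have hK : 0 < Real.exp 1 * R := by positivity
    -- The envelope with `t = 0` integrates to `K + K / e`, which is `(e + 1) * R`.
    refine (setLIntegral_mono_ae' measurableSet_Ioi (ae_of_all _ fun s hs => ?_)).trans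
      ((lintegral_tail_envelope hK hK.le).trans_eq ?_)
    · change μ (Set.Ioi s) ≤ _
      rw [← ofReal_measureReal]
      refine ENNReal.ofReal_le_ofReal ?_
      split_ifs with h
      · exact measureReal_le_one
      · rw [zero_add]
        exact hμ.tail_le_exp_revenue hr hR h0 (by linarith)
    · congr 1
      have : Real.exp 1 * Real.exp (-1) = 1 := by rw [← Real.exp_add]; simp
      linear_combination R * this

/-- Split `v = t + (v - t)` and apply the layer-cake formula to the excess. -/
theorem lintegral_Ioi_eq (μ : Measure ℝ) {t : ℝ} (ht : 0 ≤ t) :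
    ∫⁻ v in Set.Ioi t, ENNReal.ofReal v ∂μ =
      ENNReal.ofReal t * μ (Set.Ioi t) + ∫⁻ s in Set.Ioi 0, μ (Set.Ioi (t + s)) := by
  have h1 : ∫⁻ v in Set.Ioi t, ENNReal.ofReal v ∂μ =
      ∫⁻ v in Set.Ioi t, (ENNReal.ofReal t + ENNReal.ofReal (v - t)) ∂μ :=
    setLIntegral_congr_fun measurableSet_Ioi fun v hv => by
      simp only [Set.mem_Ioi] at hv
      rw [← ENNReal.ofReal_add ht (by linarith)]
      congr 1
      ring
  rw [h1, lintegral_add_left measurable_const, lintegral_const, Measure.restrict_apply_univ,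
    lintegral_eq_lintegral_meas_lt]
  · congr 1
    refine setLIntegral_congr_fun measurableSet_Ioi fun s hs => ?_
    simp only [Set.mem_Ioi] at hs
    rw [Measure.restrict_apply' measurableSet_Ioi]
    congr 1
    ext v
    simp only [Set.mem_inter_iff, Set.mem_ofPred_eq, Set.mem_Ioi]
    constructor
    · rintro ⟨h, -⟩; linarith
    · intro h; constructor <;> linarith
  · exact (ae_restrict_iff' measurableSet_Ioi).2 (ae_of_all _ fun v hv => by
      simp only [Set.mem_Ioi] at hv
      simp only [Pi.zero_apply]
      linarith)
  · fun_prop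

/-- Above a threshold `t ≥ r`, welfare is at most `e + 1` times the revenue of the price `t`. -/
theorem IsQuasiMHR.lintegral_Ioi_le (hμ : IsQuasiMHR μ) (hr : IsMonopolyReserve μ r) {t : ℝ}
    (hrt : r ≤ t) :
    ∫⁻ v in Set.Ioi t, ENNReal.ofReal v ∂μ ≤
      ENNReal.ofReal (Real.exp 1 + 1) * (ENNReal.ofReal t * μ (Set.Ioi t)) := by
  have ht : 0 ≤ t := hr.1.trans hrt
  rcases hr.revenue_nonneg.eq_or_lt with h0 | h0
  · rw [Measure.restrict_zero_set (hr.tail_eq_zero h0.symm ht)]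
    simp
  rw [lintegral_Ioi_eq μ ht]
  have hq0 : 0 ≤ μ.real (Set.Ioi t) := measureReal_nonneg
  -- The base `t` already contributes `t * q`, so the expected excess over `t` may be as large as `e
  -- * t * q`.
  suffices h : ∫⁻ s in Set.Ioi 0, μ (Set.Ioi (t + s)) ≤
      ENNReal.ofReal (Real.exp 1 * t * μ.real (Set.Ioi t)) by
    refine (add_le_add_right h _).trans_eq ?_
    rw [← ofReal_measureReal, ← ENNReal.ofReal_mul ht, ← ENNReal.ofReal_mul (by positivity),
      ← ENNReal.ofReal_add (by positivity) (by positivity)]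
    congr 1
    ring
  rcases hq0.eq_or_lt with hq | hq
  · refine (le_of_eq ?_).trans zero_le
    refine (setLIntegral_congr_fun measurableSet_Ioi fun s hs => ?_).trans
      (lintegral_zero (μ := volume.restrict (Set.Ioi (0 : ℝ))))
    refine measure_mono_null (Set.Ioi_subset_Ioi ?_)
      ((measureReal_eq_zero_iff (measure_ne_top _ _)).1 hq.symm)
    simp only [Set.mem_Ioi] at hs
    linarith
  set R := r * μ.real (Set.Ici r) with hR
  have hRt : R ≤ t := hr.revenue_le.trans hrt
  have htpos : 0 < t := h0.trans_le hRt
  set q := μ.real (Set.Ioi t) with hqdef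
  set K := Real.exp 1 * R with hKdef
  have hK : 0 < K := by positivity
  -- `q = exp (-a * t)`
  set a := -Real.log q / t with hadef
  have hqa : q = Real.exp (-(a * t)) := by
    rw [hadef, div_mul_cancel₀ _ htpos.ne', neg_neg, Real.exp_log hq]
  have hqle : q ≤ 1 := measureReal_le_one
  have ha0 : 0 ≤ a := div_nonneg (neg_nonneg.2 (Real.log_nonpos hq.le hqle)) ht
  have htail : ∀ s, 0 < s → μ.real (Set.Ioi (t + s)) ≤ q * Real.exp (-(a * s)) := fun s hs => by
    refine (hμ.tail_le_exp htpos (by linarith : t ≤ t + s) hqa.le).trans_eq ?_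
    rw [hqa, ← Real.exp_add]
    ring_nf
  have key : ∀ {f : ℝ → ℝ}, (∀ s, 0 < s → μ.real (Set.Ioi (t + s)) ≤ f s) →
      ∫⁻ s in Set.Ioi 0, μ (Set.Ioi (t + s)) ≤ ∫⁻ s in Set.Ioi 0, ENNReal.ofReal (f s) :=
    fun {f} hf => setLIntegral_mono_ae' measurableSet_Ioi (ae_of_all _ fun s hs => by
      rw [← ofReal_measureReal]
      exact ENNReal.ofReal_le_ofReal (hf s hs))
  have hKt : K ≤ Real.exp 1 * t := mul_le_mul_of_nonneg_left hRt (Real.exp_pos 1).le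
  -- Beyond `t` the tail decays at rate at least `a`. If `a ≥ 1 / K`, the excess is at most `q / a ≤
  -- q * K`, and `K = e * R ≤ e * t`. If `a` is smaller, decay at rate `a` is too weak, and the
  -- bound beyond `K` must be used as well.
  rcases le_or_gt (1 / K) a with hcase | hcase
  · have hapos : 0 < a := lt_of_lt_of_le (by positivity) hcase
    refine (key htail).trans ?_
    simp_rw [ENNReal.ofReal_mul hq.le]
    rw [lintegral_const_mul _ (by fun_prop), lintegral_exp_neg_mul_Ioi hapos,
      ← ENNReal.ofReal_mul hq.le]
    refine ENNReal.ofReal_le_ofReal ?_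
    rw [mul_zero, neg_zero, Real.exp_zero, mul_comm]
    refine mul_le_mul_of_nonneg_right (le_trans ?_ hKt) hq.le
    rw [div_le_comm₀ hapos hK]
    exact hcase
  · -- `a = l / K` with `l < 1`
    set l := a * K with hl
    have hl0 : 0 ≤ l := by positivity
    have hl1 : l ≤ 1 := by
      have := (lt_div_iff₀ hK).1 hcase
      linarith
    have hal : a = l * (1 / K) := by rw [hl]; field_simp
    have hconv : ∀ x : ℝ, Real.exp (l * x) ≤ (1 - l) + l * Real.exp x := fun x => by
      have := convexOn_exp.2 (Set.mem_univ 0) (Set.mem_univ x) (sub_nonneg.2 hl1) hl0 (by ring)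
      simpa using this
    -- At `t ≥ K` the bound beyond `K` would force `a ≥ 1 / K`.
    have htK : t < K := by
      by_contra hc
      push Not at hc
      have h1 := hμ.tail_le_exp_revenue hr hR h0 hc
      rw [← hqdef, hqa, Real.exp_le_exp] at h1
      have : a * t < 1 / K * t := mul_lt_mul_of_pos_right hcase htpos
      linarith
    -- Convexity of `exp` yields a mixture, with weights `l` and `1 - l`, of a pure exponential and
    -- the envelope. For `t + s < K`, apply it to `exp (-a * s)` at the point `-s / K`; beyond `K`,
    -- apply it at `t / K`, where `q * exp (l * t / K) = 1`.
    have henv : ∀ s, 0 < s → μ.real (Set.Ioi (t + s)) ≤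
        q * (l * Real.exp (-(1 / K * s)) + (1 - l) *
          if s < K - t then 1 else Real.exp (-(1 / K * (t + s)))) := by
      intro s hs
      split_ifs with hsK
      · refine (htail s hs).trans (mul_le_mul_of_nonneg_left ?_ hq.le)
        have := hconv (-(1 / K * s))
        rw [hal]
        refine (le_of_eq ?_).trans (this.trans_eq ?_) <;> ring_nf
      · push Not at hsK
        refine (hμ.tail_le_exp_revenue hr hR h0 (by linarith : K ≤ t + s)).trans ?_
        have h1 := hconv (1 / K * t)
        have h2 : q * Real.exp (l * (1 / K * t)) = 1 := by
          rw [hqa, hal, ← Real.exp_add]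
          ring_nf
          simp
        have h3 : Real.exp (-(1 / K * s)) = Real.exp (-(1 / K * (t + s))) * Real.exp (1 / K * t) := by
          rw [← Real.exp_add]
          ring_nf
        rw [h3]
        have h4 : 1 ≤ q * ((1 - l) + l * Real.exp (1 / K * t)) := by
          exact h2.symm.le.trans (mul_le_mul_of_nonneg_left h1 hq.le)
        have := mul_le_mul_of_nonneg_left h4 (Real.exp_pos (-(1 / K * (t + s)))).le
        rw [hKdef] at this ⊢
        linarith
    refine (key henv).trans ?_
    simp_rw [ENNReal.ofReal_mul hq.le]
    have hl1' : 0 ≤ 1 - l := by linarith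
    have hadd : ∀ s : ℝ, ENNReal.ofReal (l * Real.exp (-(1 / K * s)) + (1 - l) *
          if s < K - t then 1 else Real.exp (-(1 / K * (t + s)))) =
        ENNReal.ofReal l * ENNReal.ofReal (Real.exp (-(1 / K * s))) + ENNReal.ofReal (1 - l) *
          ENNReal.ofReal (if s < K - t then 1 else Real.exp (-(1 / K * (t + s)))) := fun s => by
      have : (0 : ℝ) ≤ if s < K - t then 1 else Real.exp (-(1 / K * (t + s))) := by
        split_ifs <;> positivity
      rw [ENNReal.ofReal_add (by positivity) (by positivity), ENNReal.ofReal_mul hl0,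
        ENNReal.ofReal_mul hl1']
    have hmeas : Measurable fun s : ℝ =>
        ENNReal.ofReal (if s < K - t then 1 else Real.exp (-(1 / K * (t + s)))) :=
      (Measurable.ite (measurableSet_lt measurable_id measurable_const) measurable_const
        (by fun_prop)).ennreal_ofReal
    simp_rw [hadd]
    rw [lintegral_const_mul _ (by fun_prop), lintegral_add_left (by fun_prop),
      lintegral_const_mul _ (by fun_prop), lintegral_const_mul _ hmeas,
      lintegral_exp_neg_mul_Ioi (by positivity), mul_zero, neg_zero, Real.exp_zero]
    refine (mul_le_mul_right (add_le_add_right (mul_le_mul_right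
      (lintegral_tail_envelope hK htK.le) _) _) _).trans ?_
    have hb : 0 ≤ K - t + K * Real.exp (-1) := by
      have : 0 ≤ K * Real.exp (-1) := by positivity
      linarith
    rw [← ENNReal.ofReal_mul hl0, ← ENNReal.ofReal_mul hl1',
      ← ENNReal.ofReal_add (by positivity) (by positivity), ← ENNReal.ofReal_mul hq.le]
    refine ENNReal.ofReal_le_ofReal ?_
    have he : K * Real.exp (-1) = R := by
      rw [hKdef, mul_right_comm, ← Real.exp_add]
      simp
    rw [he, one_div_one_div, mul_comm]
    refine mul_le_mul_of_nonneg_right ?_ hq.le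
    -- The mixture integrates to `q * (l * K + (1 - l) * (K - t + R))`, and both `K` and `K - t + R`
    -- are at most `e * t` because `R ≤ t`.
    have h1 : K - t + R ≤ Real.exp 1 * t := by linarith
    nlinarith [mul_le_mul_of_nonneg_left hKt hl0, mul_le_mul_of_nonneg_left h1 hl1']

/-- If a buyer wins above the threshold `t` (and his reserve) and loses below `t`, then his welfare
is at most `e + 1` times the revenue from charging `max r t`. -/
theorem IsQuasiMHR.lintegral_winning_le (hμ : IsQuasiMHR μ) (hr : IsMonopolyReserve μ r) {t : ℝ}
    {A : Set ℝ} (hA : MeasurableSet A) (hle : ∀ v ∈ A, t ≤ v)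
    (hge : ∀ v, t < v → r ≤ v → v ∈ A) :
    ∫⁻ v in A, ENNReal.ofReal v ∂μ ≤ ENNReal.ofReal (Real.exp 1 + 1) *
      ∫⁻ _ in A ∩ Set.Ici r, ENNReal.ofReal (max r t) ∂μ := by
  have he : (0 : ℝ) ≤ Real.exp 1 + 1 := by positivity
  rw [lintegral_const, Measure.restrict_apply_univ]
  rcases lt_or_ge t r with htr | hrt
  -- With `t < r` the buyer pays `r` exactly when `v ≥ r`, which earns `R`. The bound on the whole
  -- mean also covers his welfare at winning values below `r`, where he pays nothing.
  · have hAr : A ∩ Set.Ici r = Set.Ici r :=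
      Set.inter_eq_right.2 fun v hv => hge v (htr.trans_le hv) hv
    rw [hAr, max_eq_left htr.le]
    refine (setLIntegral_le_lintegral _ _).trans ((hμ.lintegral_le hr).trans_eq ?_)
    rw [ENNReal.ofReal_mul he, ENNReal.ofReal_mul hr.1, ofReal_measureReal]
  · have hAr : A ∩ Set.Ici r = A :=
      Set.inter_eq_left.2 fun v hv => hrt.trans (hle v hv)
    have hI : Set.Ioi t ⊆ A := fun v hv => hge v hv (hrt.trans (le_of_lt hv))
    -- Tie-breaking decides whether `t` itself wins. At this possible atom the value equals the
    -- price, so it does no harm.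
    have hsplit : A = Set.Ioi t ∪ A ∩ {t} := by
      ext v
      constructor
      · intro hv
        rcases (hle v hv).eq_or_lt with h | h
        · exact Or.inr ⟨hv, h.symm⟩
        · exact Or.inl h
      · rintro (h | h)
        · exact hI h
        · exact h.1
    have hdisj : Disjoint (Set.Ioi t) (A ∩ {t}) := by
      rw [Set.disjoint_left]
      rintro v hv ⟨-, h⟩
      simp only [Set.mem_singleton_iff] at h
      simp only [Set.mem_Ioi] at hv
      exact hv.ne h.symm
    have hmeas : MeasurableSet (A ∩ {t}) := hA.inter (measurableSet_singleton t)
    rw [hAr, max_eq_right hrt]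
    have h1 : ∫⁻ v in A, ENNReal.ofReal v ∂μ =
        ∫⁻ v in Set.Ioi t, ENNReal.ofReal v ∂μ + ∫⁻ v in A ∩ {t}, ENNReal.ofReal v ∂μ := by
      conv_lhs => rw [hsplit]
      exact lintegral_union hmeas hdisj
    have h2 : μ A = μ (Set.Ioi t) + μ (A ∩ {t}) := by
      conv_lhs => rw [hsplit]
      exact measure_union hdisj hmeas
    have h3 : ∫⁻ v in A ∩ {t}, ENNReal.ofReal v ∂μ = ENNReal.ofReal t * μ (A ∩ {t}) := by
      rw [setLIntegral_congr_fun (g := fun _ => ENNReal.ofReal t) hmeas fun v hv => by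
        rw [Set.mem_singleton_iff.1 hv.2]]
      simp
    rw [h1, h2, h3, mul_add, mul_add]
    refine add_le_add (hμ.lintegral_Ioi_le hr hrt) ?_
    refine le_mul_of_one_le_left zero_le ?_
    rw [ENNReal.one_le_ofReal]
    linarith [Real.exp_pos 1]

end SingleBuyer

/-! ### Welfare, thresholds and payments -/

section Welfare

variable {ι : Type*} [DecidableEq ι]

theorem le_maxWelfare {X : Finset (Finset ι)} (v : ι → ℝ) {S : Finset ι} (hS : S ∈ X) :
    welfare v S ≤ maxWelfare X v :=
  le_csSup (X.finite_toSet.image _).bddAbove ⟨S, hS, rfl⟩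

theorem maxWelfare_le {X : Finset (Finset ι)} (hX : X.Nonempty) {v : ι → ℝ} {c : ℝ}
    (h : ∀ S ∈ X, welfare v S ≤ c) : maxWelfare X v ≤ c :=
  csSup_le (Set.Nonempty.image _ hX) (by rintro _ ⟨S, hS, rfl⟩; exact h S hS)

theorem welfare_update_of_notMem (v : ι → ℝ) {i : ι} (b : ℝ) {S : Finset ι} (hi : i ∉ S) :
    welfare (Function.update v i b) S = welfare v S :=
  Finset.sum_congr rfl fun _ hj => Function.update_of_ne (ne_of_mem_of_not_mem hj hi) b v

theorem add_welfare_erase (v : ι → ℝ) {i : ι} {S : Finset ι} (hi : i ∈ S) :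
    v i + welfare v (S.erase i) = welfare v S :=
  Finset.add_sum_erase S v hi

theorem measurable_welfare (S : Finset ι) : Measurable fun v : ι → ℝ => welfare v S := by
  unfold welfare
  fun_prop

theorem measurable_maxWelfare (X : Finset (Finset ι)) :
    Measurable fun v : ι → ℝ => maxWelfare X v := by
  rcases X.eq_empty_or_nonempty with rfl | hX
  · simp [maxWelfare]
  have : (fun v : ι → ℝ => maxWelfare X v) = X.sup' hX fun S v => welfare v S := by
    ext v
    rw [Finset.sup'_apply]
    refine le_antisymm (maxWelfare_le hX fun S hS => Finset.le_sup' (fun S => welfare v S) hS)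
      (Finset.sup'_le hX _ fun S hS => le_maxWelfare v hS)
  rw [this]
  exact Finset.measurable_sup' hX fun S _ => measurable_welfare S

theorem measurable_vcgPayment (X : Finset (Finset ι)) (W : Finset ι) (i : ι) :
    Measurable fun v : ι → ℝ => vcgPayment X v W i :=
  (measurable_maxWelfare _).sub (measurable_welfare _)

end Welfare

/-- A measurable choice among finitely many measurable functions is measurable. -/
theorem measurable_of_finite_choice {α β γ : Type*} [MeasurableSpace α] [MeasurableSpace γ]
    [Finite β] {c : α → β} (hc : ∀ b, MeasurableSet {a | c a = b}) {F : β → α → γ}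
    (hF : ∀ b, Measurable (F b)) : Measurable fun a => F (c a) a := by
  intro s hs
  have : (fun a => F (c a) a) ⁻¹' s = ⋃ b, ({a | c a = b} ∩ F b ⁻¹' s) := by
    ext a
    simp
  rw [this]
  exact MeasurableSet.iUnion fun b => (hc b).inter (hF b hs)

section Winners

variable {ι : Type*} [Fintype ι] [DecidableEq ι]

/-- `Y` offers the feasible sets all of whose members pass an individual screening `P`. -/
def IsScreenedFamily (X : Finset (Finset ι)) (P : ι → ℝ → Prop)
    (Y : (ι → ℝ) → Finset (Finset ι)) : Prop :=
  ∀ v S, S ∈ Y v ↔ S ∈ X ∧ ∀ i ∈ S, P i (v i)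

variable {X : Finset (Finset ι)} {P : ι → ℝ → Prop} {Y : (ι → ℝ) → Finset (Finset ι)}
  {w : (ι → ℝ) → Finset ι}

theorem isScreenedFamily_eagerFamily (X : Finset (Finset ι)) (r : ι → ℝ) :
    IsScreenedFamily X (fun i x => r i ≤ x) (eagerFamily X r) := fun v S => by
  simp [eagerFamily]

theorem isScreenedFamily_const (X : Finset (Finset ι)) :
    IsScreenedFamily X (fun _ _ => True) (fun _ => X) := fun v S => by simp

theorem IsScreenedFamily.measurableSet_eq (hY : IsScreenedFamily X P Y)
    (hP : ∀ i, MeasurableSet {x | P i x}) (Z : Finset (Finset ι)) :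
    MeasurableSet {v | Y v = Z} := by
  have h1 : ∀ S, MeasurableSet {v | S ∈ Y v} := fun S => by
    have : {v | S ∈ Y v} = {_v | S ∈ X} ∩ ⋂ i ∈ S, {v | P i (v i)} := by
      ext v
      simp [hY v S]
    rw [this]
    exact (MeasurableSet.const _).inter (Finset.measurableSet_biInter S fun i _ =>
      measurable_pi_apply i (hP i))
  have : {v | Y v = Z} = ⋂ S, {v | S ∈ Y v ↔ S ∈ Z} := by
    ext v
    simp [Finset.ext_iff]
  rw [this]
  refine MeasurableSet.iInter fun S => ?_
  by_cases hS : S ∈ Z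
  · simpa [hS] using h1 S
  · simp only [hS, iff_false]
    exact (h1 S).compl

theorem IsWinnerRule.measurableSet_mem (hw : IsWinnerRule Y w) (i : ι) :
    MeasurableSet {v | i ∈ w v} :=
  measurable_of_finite_choice (γ := Prop) hw.measurable (F := fun S _ => i ∈ S)
    (fun _ => measurable_const) |>.setOf

/-- Given the values of the others, a buyer faces a threshold price, which is his VCG payment. -/
theorem IsWinnerRule.exists_threshold (hX : IsDownwardClosed X) (hY : IsScreenedFamily X P Y)
    (hw : IsWinnerRule Y w) (v : ι → ℝ) (i : ι)
    (h : ∃ b, i ∈ w (Function.update v i b)) :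
    ∃ t : ℝ, (∀ b, i ∈ w (Function.update v i b) →
        t ≤ b ∧ vcgPayment (Y (Function.update v i b)) (Function.update v i b)
          (w (Function.update v i b)) i = t) ∧
      ∀ b, t < b → P i b → i ∈ w (Function.update v i b) := by
  obtain ⟨c, hc⟩ := h
  have hmem : ∀ {b b' : ℝ} {S : Finset ι}, (i ∈ S → P i b') →
      S ∈ Y (Function.update v i b) → S ∈ Y (Function.update v i b') := by
    intro b b' S hi hS
    rw [hY] at hS ⊢
    refine ⟨hS.1, fun j hj => ?_⟩
    rcases eq_or_ne j i with rfl | hne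
    · simpa using hi hj
    · simpa [Function.update_of_ne hne] using hS.2 j hj
  have hP : ∀ {b}, i ∈ w (Function.update v i b) → P i b := fun {b} hb => by
    have := ((hY _ _).1 (hw.mem (Function.update v i b))).2 i hb
    simpa using this
  have herase : ∀ (b : ℝ) (S : Finset ι), welfare (Function.update v i b) (S.erase i) =
      welfare v (S.erase i) := fun b S => welfare_update_of_notMem v b (Finset.notMem_erase i S)
  -- At any two winning reports of `i` the others obtain the same welfare: each winning set is
  -- available at the other report and the value of `i` cancels. Hence the threshold below does not
  -- depend on the report.
  have hopt : ∀ {b b' : ℝ}, i ∈ w (Function.update v i b) → i ∈ w (Function.update v i b') →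
      welfare v ((w (Function.update v i b)).erase i) ≤
        welfare v ((w (Function.update v i b')).erase i) := by
    intro b b' hb hb'
    have h1 := hw.optimal (Function.update v i b') _
      (hmem (fun _ => hP hb') (hw.mem (Function.update v i b)))
    rw [← add_welfare_erase _ hb, ← add_welfare_erase _ hb', herase, herase] at h1
    linarith
  set m : ℝ := maxWelfare ((Y (Function.update v i c)).filter (fun S => i ∉ S))
    (Function.update v i c) with hm
  -- The report of `i` affects neither which sets without `i` are offered nor their welfare, so `m`
  -- is independent of it.
  have hfam : ∀ b, (Y (Function.update v i b)).filter (fun S => i ∉ S) =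
      (Y (Function.update v i c)).filter (fun S => i ∉ S) := fun b => by
    ext S
    simp only [Finset.mem_filter]
    exact ⟨fun h => ⟨hmem (fun hi => absurd hi h.2) h.1, h.2⟩,
      fun h => ⟨hmem (fun hi => absurd hi h.2) h.1, h.2⟩⟩
  have hne : ((Y (Function.update v i c)).filter (fun S => i ∉ S)).Nonempty :=
    ⟨∅, by simp [hY _ _, hX.empty_mem]⟩
  have hmb : ∀ b, maxWelfare ((Y (Function.update v i b)).filter (fun S => i ∉ S))
      (Function.update v i b) = m := fun b => by
    rw [hfam b, hm, maxWelfare, maxWelfare]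
    congr 1
    refine Set.image_congr fun S hS => ?_
    have hiS : i ∉ S := (Finset.mem_filter.1 hS).2
    rw [welfare_update_of_notMem _ _ hiS, welfare_update_of_notMem _ _ hiS]
  refine ⟨m - welfare v ((w (Function.update v i c)).erase i), fun b hb => ⟨?_, ?_⟩, ?_⟩
  · have h1 : m ≤ welfare (Function.update v i b) (w (Function.update v i b)) := by
      rw [← hmb b]
      refine maxWelfare_le (by rw [hfam b]; exact hne) fun S hS => ?_
      exact hw.optimal _ S (Finset.mem_filter.1 hS).1
    rw [← add_welfare_erase _ hb, herase, Function.update_self] at h1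
    have := hopt hb hc
    linarith
  · rw [vcgPayment, hmb b, herase, le_antisymm (hopt hb hc) (hopt hc hb)]
  · intro b hb hPb
    by_contra hi
    have h1 := hw.optimal (Function.update v i b) _
      (hmem (fun _ => hPb) (hw.mem (Function.update v i c)))
    have h2 : welfare (Function.update v i b) (w (Function.update v i b)) ≤ m := by
      rw [← hmb b]
      exact le_maxWelfare _ (Finset.mem_filter.2 ⟨hw.mem _, hi⟩)
    rw [← add_welfare_erase _ hc, herase, Function.update_self] at h1
    linarith

end Winners

/-! ### Integrating over the profile one buyer at a time -/

/-- Resampling one coordinate independently preserves the product measure. This freezes the other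
buyers so that the single-buyer bounds apply to buyer `i`. -/
theorem lintegral_pi_eq_lintegral_update {ι : Type*} [Fintype ι] [DecidableEq ι]
    (μ : ι → Measure ℝ) [∀ i, IsProbabilityMeasure (μ i)] (i : ι) {f : (ι → ℝ) → ENNReal}
    (hf : Measurable f) :
    ∫⁻ v, f v ∂(Measure.pi μ) =
      ∫⁻ v, ∫⁻ b, f (Function.update v i b) ∂(μ i) ∂(Measure.pi μ) := by
  have hg : Measurable fun v => ∫⁻ b, f (Function.update v i b) ∂(μ i) := by
    have := hf.lmarginal μ (s := {i})
    rwa [lmarginal_singleton] at this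
  have x : ι → ℝ := fun _ => 0
  rw [lintegral_eq_lmarginal_univ x, lintegral_eq_lmarginal_univ x,
    lmarginal_erase' _ hf (Finset.mem_univ i), lmarginal_erase' _ hg (Finset.mem_univ i)]
  simp

section Revenue

variable {ι : Type*} [Fintype ι] [DecidableEq ι]
variable {X : Finset (Finset ι)} {P : ι → ℝ → Prop} {Y : (ι → ℝ) → Finset (Finset ι)}
  {w : (ι → ℝ) → Finset ι}

/-- The welfare of the VCG winners is at most `e + 1` times the revenue with monopoly reserves,
provided that the buyers who are screened out are below their reserves. -/
theorem IsWinnerRule.lintegral_welfare_le (hX : IsDownwardClosed X)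
    (hY : IsScreenedFamily X P Y) (hw : IsWinnerRule Y w) (μ : ι → Measure ℝ)
    [∀ i, IsProbabilityMeasure (μ i)] (hμ : ∀ i, IsQuasiMHR (μ i)) {r : ι → ℝ}
    (hr : ∀ i, IsMonopolyReserve (μ i) (r i)) (hP : ∀ i, MeasurableSet {x | P i x})
    (hPr : ∀ i x, r i ≤ x → P i x) :
    ∫⁻ v, ∑ i ∈ w v, ENNReal.ofReal (v i) ∂(Measure.pi μ) ≤
      ENNReal.ofReal (Real.exp 1 + 1) *
        ∫⁻ v, ∑ i ∈ (w v).filter (fun i => r i ≤ v i),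
          ENNReal.ofReal (max (r i) (vcgPayment (Y v) v (w v) i)) ∂(Measure.pi μ) := by
  classical
  have hmem := hw.measurableSet_mem
  have hmem' : ∀ i, MeasurableSet {v : ι → ℝ | i ∈ w v ∧ r i ≤ v i} := fun i =>
    (hmem i).inter (measurableSet_le measurable_const (measurable_pi_apply i))
  have hf : ∀ i, Measurable ({v : ι → ℝ | i ∈ w v}.indicator fun v => ENNReal.ofReal (v i)) :=
    fun i => (measurable_pi_apply i).ennreal_ofReal.indicator (hmem i)
  have hpay : ∀ i, Measurable fun v => vcgPayment (Y v) v (w v) i := fun i =>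
    measurable_of_finite_choice (hY.measurableSet_eq hP)
      (F := fun Z v => vcgPayment Z v (w v) i) fun Z =>
        measurable_of_finite_choice hw.measurable (F := fun W v => vcgPayment Z v W i) fun W =>
          measurable_vcgPayment Z W i
  have hg : ∀ i, Measurable ({v : ι → ℝ | i ∈ w v ∧ r i ≤ v i}.indicator fun v =>
      ENNReal.ofReal (max (r i) (vcgPayment (Y v) v (w v) i))) := fun i =>
    (measurable_const.max (hpay i)).ennreal_ofReal.indicator (hmem' i)
  have h1 : ∀ v : ι → ℝ, ∑ i ∈ w v, ENNReal.ofReal (v i) =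
      ∑ i, {v : ι → ℝ | i ∈ w v}.indicator (fun v => ENNReal.ofReal (v i)) v := fun v => by
    simp [Set.indicator_apply]
  have h2 : ∀ v : ι → ℝ, ∑ i ∈ (w v).filter (fun i => r i ≤ v i),
      ENNReal.ofReal (max (r i) (vcgPayment (Y v) v (w v) i)) =
      ∑ i, {v : ι → ℝ | i ∈ w v ∧ r i ≤ v i}.indicator (fun v =>
        ENNReal.ofReal (max (r i) (vcgPayment (Y v) v (w v) i))) v := fun v => by
    simp only [Set.indicator_apply, Set.mem_ofPred_eq, ← Finset.sum_filter]
    refine Finset.sum_congr ?_ fun _ _ => rfl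
    ext i
    simp
  simp_rw [h1, h2]
  rw [lintegral_finsetSum _ fun i _ => hf i, lintegral_finsetSum _ fun i _ => hg i,
    Finset.mul_sum]
  refine Finset.sum_le_sum fun i _ => ?_
  rw [lintegral_pi_eq_lintegral_update μ i (hf i), lintegral_pi_eq_lintegral_update μ i (hg i),
    ← lintegral_const_mul' _ _ ENNReal.ofReal_ne_top]
  refine lintegral_mono fun v => ?_
  by_cases hwin : ∃ b, i ∈ w (Function.update v i b)
  · obtain ⟨t, ht1, ht2⟩ := hw.exists_threshold hX hY v i hwin
    set A : Set ℝ := {b | i ∈ w (Function.update v i b)} with hA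
    have hAm : MeasurableSet A := (measurable_update v) (hmem i)
    have := (hμ i).lintegral_winning_le (hr i) hAm (fun b hb => (ht1 b hb).1)
      (fun b hb hrb => ht2 b hb (hPr i b hrb))
    rw [← lintegral_indicator hAm, ← lintegral_indicator (hAm.inter measurableSet_Ici)] at this
    refine (lintegral_mono fun b => ?_).trans (this.trans (mul_le_mul_right
      (lintegral_mono fun b => ?_) _))
    · by_cases hb : i ∈ w (Function.update v i b) <;> simp [hA, hb]
    · by_cases hb : i ∈ w (Function.update v i b)
      · simp [Set.indicator_apply, hA, hb, (ht1 b hb).2]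
      · simp [hA, hb]
  · push Not at hwin
    simp [hwin]

end Revenue

/-! ### Revenue of an incentive compatible menu against the welfare above the monopoly reserve -/

section Menu

/-- The allocation `x` and payment `p` of an incentive compatible and individually rational menu
for the types in `T`. -/
structure IsMenu (T : Set ℝ) (x p : ℝ → ℝ) : Prop where
  alloc_nonneg : ∀ t ∈ T, 0 ≤ x t
  alloc_le_one : ∀ t ∈ T, x t ≤ 1
  pay_nonneg : ∀ t ∈ T, 0 ≤ p t
  pay_le : ∀ t ∈ T, p t ≤ t * x t
  incentive_compatible : ∀ t ∈ T, ∀ b ∈ T, t * x b - p b ≤ t * x t - p t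

/-- The best utility per unit of value that type `s` gets from the options of the types in `B`. -/
def menuRate (B : Set ℝ) (x p : ℝ → ℝ) (s : ℝ) : ℝ :=
  -- The value `0` for `s ≤ 0` makes the rate monotone on all of `ℝ` and gives it the initial value
  -- `0`. For `s > 0` it is `U s / s`, with `U` the indirect utility from the options of `B` and
  -- opting out.
  if s ≤ 0 then 0 else sSup ((fun b => max 0 (x b - p b / s)) '' B)

variable {T B : Set ℝ} {x p : ℝ → ℝ}

theorem IsMenu.mono (h : IsMenu T x p) (hBT : B ⊆ T) : IsMenu B x p where
  alloc_nonneg t ht := h.alloc_nonneg t (hBT ht)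
  alloc_le_one t ht := h.alloc_le_one t (hBT ht)
  pay_nonneg t ht := h.pay_nonneg t (hBT ht)
  pay_le t ht := h.pay_le t (hBT ht)
  incentive_compatible t ht b hb := h.incentive_compatible t (hBT ht) b (hBT hb)

theorem IsMenu.le_menuRate (h : IsMenu B x p) {s b : ℝ} (hs : 0 < s) (hb : b ∈ B) :
    max 0 (x b - p b / s) ≤ menuRate B x p s := by
  rw [menuRate, if_neg hs.not_ge]
  refine le_csSup ⟨1, ?_⟩ ⟨b, hb, rfl⟩
  rintro _ ⟨c, hc, rfl⟩
  have := div_nonneg (h.pay_nonneg c hc) hs.le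
  exact max_le zero_le_one (by linarith [h.alloc_le_one c hc])

theorem menuRate_le (hB : B.Nonempty) {s m : ℝ} (hs : 0 < s)
    (h : ∀ b ∈ B, max 0 (x b - p b / s) ≤ m) : menuRate B x p s ≤ m := by
  rw [menuRate, if_neg hs.not_ge]
  exact csSup_le (hB.image _) (by rintro _ ⟨b, hb, rfl⟩; exact h b hb)

theorem menuRate_nonneg (s : ℝ) : 0 ≤ menuRate B x p s := by
  rw [menuRate]
  split_ifs
  · exact le_rfl
  · exact Real.sSup_nonneg (by rintro _ ⟨b, -, rfl⟩; exact le_max_left _ _)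

theorem IsMenu.monotone_menuRate (h : IsMenu B x p) (hB : B.Nonempty) :
    Monotone (menuRate B x p) := by
  intro s s' hss
  rcases le_or_gt s 0 with hs | hs
  · conv_lhs => rw [menuRate, if_pos hs]
    exact menuRate_nonneg s'
  · refine menuRate_le hB hs fun b hb => le_trans ?_ (h.le_menuRate (hs.trans_le hss) hb)
    have := div_le_div_of_nonneg_left (h.pay_nonneg b hb) hs hss
    exact max_le_max le_rfl (by linarith)

/-- An option `c` with `p c ≥ p b` gains at least `p b * (1 / s - 1 / s')` in rate between `s` and
`s'`. A cheaper option is no better than `b` for types above `b`, since type `b` already weakly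
prefers his own; neither is opting out. -/
theorem IsMenu.menuRate_add_le (h : IsMenu B x p) (hB0 : ∀ b ∈ B, 0 ≤ b) {b s s' : ℝ}
    (hb : b ∈ B) (hbs : b < s) (hss : s ≤ s') :
    menuRate B x p s + p b / s ≤ menuRate B x p s' + p b / s' := by
  have hs : 0 < s := (hB0 b hb).trans_lt hbs
  have hs' : 0 < s' := hs.trans_le hss
  have hinv : 0 ≤ 1 / s - 1 / s' := sub_nonneg.2 (one_div_le_one_div_of_le hs hss)
  have hdiv : ∀ y : ℝ, y / s - y / s' = y * (1 / s - 1 / s') := fun y => by ring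
  suffices h' : menuRate B x p s ≤ menuRate B x p s' - p b * (1 / s - 1 / s') by
    linarith [hdiv (p b)]
  have hlow : ∀ c ∈ B, p b ≤ p c → x c - p c / s ≤ menuRate B x p s' - p b * (1 / s - 1 / s') := by
    intro c hc hpc
    have h1 := (le_max_right _ _).trans (h.le_menuRate hs' hc)
    have h2 := mul_le_mul_of_nonneg_right hpc hinv
    linarith [hdiv (p c)]
  have hself := hlow b hb le_rfl
  refine menuRate_le ⟨b, hb⟩ hs fun c hc => max_le (le_trans ?_ hself) ?_
  · rw [sub_nonneg, div_le_iff₀ hs]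
    have := mul_le_mul_of_nonneg_right hbs.le (h.alloc_nonneg b hb)
    linarith [h.pay_le b hb]
  · rcases le_or_gt (p b) (p c) with hpc | hpc
    · exact hlow c hc hpc
    · refine le_trans ?_ hself
      have hic := h.incentive_compatible b hb c hc
      have hbpos : 0 < b := by
        refine (hB0 b hb).lt_of_ne ?_
        rintro rfl
        simp only [zero_mul, zero_sub] at hic
        linarith
      have h1 : x c - x b ≤ (p c - p b) / b := by
        rw [le_div_iff₀ hbpos]
        linarith
      have h2 : (p c - p b) / b ≤ (p c - p b) / s := by
        rw [div_le_div_iff₀ hbpos hs]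
        nlinarith
      have h3 : (p c - p b) / s = p c / s - p b / s := sub_div _ _ _
      linarith

/-- This is the payment identity `s ^ 2 * (U s / s)' = s * U' s - U s` in inequality form, obtained
by differentiating the monotone function `menuRate + p b / s`. -/
theorem IsMenu.le_deriv_menuRate (h : IsMenu B x p) (hB0 : ∀ b ∈ B, 0 ≤ b) {b s : ℝ}
    (hb : b ∈ B) (hbs : b < s) (hd : DifferentiableAt ℝ (menuRate B x p) s) :
    p b ≤ s ^ 2 * deriv (menuRate B x p) s := by
  have hs : 0 < s := (hB0 b hb).trans_lt hbs
  have hmono : MonotoneOn (fun y => menuRate B x p y + p b * y⁻¹) (Set.Ioi b) :=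
    fun y hy y' _ hyy => h.menuRate_add_le hB0 hb hy hyy
  have hderiv : HasDerivAt (fun y => menuRate B x p y + p b * y⁻¹)
      (deriv (menuRate B x p) s + p b * (-(s ^ 2)⁻¹)) s :=
    hd.hasDerivAt.add ((hasDerivAt_inv hs.ne').const_mul _)
  have h0 := hmono.derivWithin_nonneg (x := s)
  rw [derivWithin_of_mem_nhds (Ioi_mem_nhds hbs), hderiv.deriv] at h0
  have h1 := mul_nonneg (sq_nonneg s) h0
  have h2 : s ^ 2 * (s ^ 2)⁻¹ = 1 := mul_inv_cancel₀ (by positivity)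
  linear_combination h1 - p b * h2

/-- Only this inequality of Lebesgue is needed, so absolute continuity of the rate plays no role. -/
theorem lintegral_deriv_le_of_monotone {f : ℝ → ℝ} (hf : Monotone f) {a b : ℝ} (hab : a ≤ b) :
    ∫⁻ s in Set.Ioo a b, ENNReal.ofReal (deriv f s) ≤ ENNReal.ofReal (f b - f a) := by
  have h1 : IntervalIntegrable (deriv f) volume a b :=
    (hf.monotoneOn _).intervalIntegrable_deriv
  have h2 := (hf.monotoneOn (Set.uIcc a b)).intervalIntegral_deriv_mem_uIcc
  rw [Set.uIcc_of_le (sub_nonneg.2 (hf hab)), intervalIntegral.integral_of_le hab,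
    integral_Ioc_eq_integral_Ioo] at h2
  rw [intervalIntegrable_iff_integrableOn_Ioo_of_le hab] at h1
  rw [← ofReal_integral_eq_lintegral_ofReal h1 (ae_of_all _ fun s => hf.deriv_nonneg)]
  exact ENNReal.ofReal_le_ofReal h2.2

theorem lintegral_div_sq_Ioo {c a b : ℝ} (hc : 0 ≤ c) (ha : 0 < a) (hab : a ≤ b) :
    ∫⁻ s in Set.Ioo a b, ENNReal.ofReal (c / s ^ 2) = ENNReal.ofReal (c / a - c / b) := by
  have hpos : ∀ s ∈ Set.uIcc a b, 0 < s := fun s hs => by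
    rw [Set.uIcc_of_le hab] at hs
    exact ha.trans_le hs.1
  have hcont : ContinuousOn (fun s : ℝ => c / s ^ 2) (Set.uIcc a b) :=
    continuousOn_const.div (by fun_prop) fun s hs => (pow_pos (hpos s hs) 2).ne'
  have h1 := hcont.intervalIntegrable (μ := volume)
  have h2 : ∫ s in a..b, c / s ^ 2 = c / a - c / b := by
    rw [intervalIntegral.integral_eq_sub_of_hasDerivAt (f := fun s => -(c * s⁻¹)) (fun s hs => ?_) h1]
    · ring
    · convert! ((hasDerivAt_inv (hpos s hs).ne').const_mul c).neg using 1
      ring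
  rw [← h2, intervalIntegral.integral_of_le hab, integral_Ioc_eq_integral_Ioo]
  rw [intervalIntegrable_iff_integrableOn_Ioo_of_le hab] at h1
  exact (ofReal_integral_eq_lintegral_ofReal h1 (ae_of_all _ fun s => by positivity)).symm

variable {μ : Measure ℝ} [IsProbabilityMeasure μ] {r : ℝ}

/-- Below the reserve, a value distribution is dominated by the equal revenue distribution. -/
theorem IsMonopolyReserve.measure_Ico_le (hr : IsMonopolyReserve μ r) {s : ℝ} (hs : 0 < s)
    (hsr : s ≤ r) :
    μ (Set.Ico s r) ≤
      ∫⁻ y in Set.Ioo s r, ENNReal.ofReal (r * μ.real (Set.Ici r) / y ^ 2) := by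
  rw [lintegral_div_sq_Ioo hr.revenue_nonneg hs hsr, ← ofReal_measureReal]
  refine ENNReal.ofReal_le_ofReal ?_
  have h1 : Set.Ico s r = Set.Ici s \ Set.Ici r := by
    ext y
    simp
  rw [h1, measureReal_sdiff (Set.Ici_subset_Ici.2 hsr) measurableSet_Ici,
    mul_div_cancel_left₀ _ (hs.trans_le hsr).ne']
  have h2 := hr.2 s hs.le
  have h3 : μ.real (Set.Ici s) ≤ r * μ.real (Set.Ici r) / s := by
    rw [le_div_iff₀ hs]
    linarith
  linarith

/-- The payments of the types below the reserve are covered by what a type at the reserve would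
gain from their options. -/
theorem IsMenu.lintegral_Iio_pay_le (h : IsMenu T x p) (hp : Measurable p)
    (hr : IsMonopolyReserve μ r) (hT0 : ∀ t ∈ T, 0 ≤ t) (hT : ∀ᵐ t ∂μ, t ∈ T)
    (hB : (T ∩ Set.Iio r).Nonempty) :
    ∫⁻ t in Set.Iio r, ENNReal.ofReal (p t) ∂μ ≤
      ENNReal.ofReal (r * menuRate (T ∩ Set.Iio r) x p r) * μ (Set.Ici r) := by
  set B := T ∩ Set.Iio r with hBdef
  have hmB : IsMenu B x p := h.mono Set.inter_subset_left
  have hB0 : ∀ b ∈ B, 0 ≤ b := fun b hb => hT0 b hb.1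
  have hmono := hmB.monotone_menuRate hB
  have hrpos : 0 < r := by
    obtain ⟨b, hb⟩ := hB
    exact (hB0 b hb).trans_lt hb.2
  set c : ℝ := r * μ.real (Set.Ici r) with hc
  -- The equal-revenue density `c / s ^ 2` cancels the factor `s ^ 2` in `f`, leaving the derivative
  -- of the rate to be integrated over `(0, r)`.
  set ν : Measure ℝ := (volume.restrict (Set.Ioo 0 r)).withDensity
    fun s => ENNReal.ofReal (c / s ^ 2) with hν
  set f : ℝ → ℝ := fun s => s ^ 2 * deriv (menuRate B x p) s with hf
  have hfm : Measurable f := (measurable_id.pow_const 2).mul (measurable_deriv _)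
  have hνac : ν ≪ volume :=
    (withDensity_absolutelyContinuous _ _).trans Measure.absolutelyContinuous_restrict
  have hdens : Measurable fun s : ℝ => ENNReal.ofReal (c / s ^ 2) := by fun_prop
  have hdiff : ∀ᵐ s ∂ν, DifferentiableAt ℝ (menuRate B x p) s :=
    hνac.ae_le hmono.ae_differentiableAt
  have hT' : ∀ᵐ t ∂(μ.restrict (Set.Iio r)), t ∈ B := by
    rw [ae_restrict_iff' measurableSet_Iio]
    filter_upwards [hT] with t ht htr using ⟨ht, htr⟩
  -- Level sets are compared. Types below `r` paying more than `y` lie in `[s₀, r)`, whose mass is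
  -- at most `ν (s₀, r)`. Almost every `s` in `(s₀, r)` lies above a type `b` with `p b > y`, so `f
  -- s > y`.
  have hstep : ∀ y : ℝ, 0 < y →
      (μ.restrict (Set.Iio r)) {t | y < p t} ≤ ν {s | y < f s} := by
    intro y hy
    set E : Set ℝ := {b | b ∈ B ∧ y < p b} with hE
    rcases E.eq_empty_or_nonempty with hE0 | hE0
    · refine (le_of_eq ?_).trans zero_le
      rw [measure_eq_zero_iff_ae_notMem]
      filter_upwards [hT'] with t ht hyt
      exact (Set.eq_empty_iff_forall_notMem.1 hE0) t ⟨ht, hyt⟩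
    have hyE : ∀ b ∈ E, y ≤ b := fun b hb => by
      have h1 := hmB.pay_le b hb.1
      have h2 := mul_le_of_le_one_right (hB0 b hb.1) (hmB.alloc_le_one b hb.1)
      linarith [hb.2]
    have hbdd : BddBelow E := ⟨y, hyE⟩
    set s₀ := sInf E with hs₀
    have hs₀pos : 0 < s₀ := hy.trans_le (le_csInf hE0 hyE)
    have hs₀r : s₀ ≤ r := by
      obtain ⟨b, hb⟩ := hE0
      exact (csInf_le hbdd hb).trans (le_of_lt hb.1.2)
    calc (μ.restrict (Set.Iio r)) {t | y < p t}
        ≤ (μ.restrict (Set.Iio r)) (Set.Ico s₀ r) := by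
          refine measure_mono_ae ?_
          filter_upwards [hT'] with t ht hyt
          exact ⟨csInf_le hbdd ⟨ht, hyt⟩, ht.2⟩
      _ ≤ μ (Set.Ico s₀ r) := Measure.restrict_apply_le _ _
      _ ≤ _ := hr.measure_Ico_le hs₀pos hs₀r
      _ = ν (Set.Ioo s₀ r) := by
          rw [hν, withDensity_apply _ measurableSet_Ioo, Measure.restrict_restrict measurableSet_Ioo,
            Set.inter_eq_left.2 (Set.Ioo_subset_Ioo_left hs₀pos.le)]
      _ ≤ ν {s | y < f s} := by
          refine measure_mono_ae ?_
          filter_upwards [hdiff] with s hs hsI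
          obtain ⟨b, hb, hbs⟩ := exists_lt_of_csInf_lt hE0 hsI.1
          exact hb.2.trans_le (hmB.le_deriv_menuRate hB0 hb.1 hbs hs)
  calc ∫⁻ t in Set.Iio r, ENNReal.ofReal (p t) ∂μ
      = ∫⁻ y in Set.Ioi 0, (μ.restrict (Set.Iio r)) {t | y < p t} :=
        lintegral_eq_lintegral_meas_lt _
          (hT'.mono fun t ht => hmB.pay_nonneg t ht) hp.aemeasurable
    _ ≤ ∫⁻ y in Set.Ioi 0, ν {s | y < f s} :=
        setLIntegral_mono_ae' measurableSet_Ioi (ae_of_all _ fun y hy => hstep y hy)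
    _ = ∫⁻ s, ENNReal.ofReal (f s) ∂ν :=
        (lintegral_eq_lintegral_meas_lt _ (ae_of_all _ fun s =>
          mul_nonneg (sq_nonneg s) hmono.deriv_nonneg) hfm.aemeasurable).symm
    _ = ∫⁻ s in Set.Ioo 0 r, ENNReal.ofReal c * ENNReal.ofReal (deriv (menuRate B x p) s) := by
        rw [hν, lintegral_withDensity_eq_lintegral_mul _ hdens hfm.ennreal_ofReal]
        refine setLIntegral_congr_fun measurableSet_Ioo fun s hs => ?_
        have hspos : 0 < s := hs.1
        rw [Pi.mul_apply, ← ENNReal.ofReal_mul (div_nonneg hr.revenue_nonneg (sq_nonneg s)),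
          ← ENNReal.ofReal_mul hr.revenue_nonneg]
        congr 1
        simp only [hf]
        field_simp
    _ = ENNReal.ofReal c * ∫⁻ s in Set.Ioo 0 r, ENNReal.ofReal (deriv (menuRate B x p) s) :=
        lintegral_const_mul _ (measurable_deriv _).ennreal_ofReal
    _ ≤ ENNReal.ofReal c * ENNReal.ofReal (menuRate B x p r - menuRate B x p 0) :=
        mul_le_mul_right (lintegral_deriv_le_of_monotone hmono hrpos.le) _
    _ = ENNReal.ofReal (r * menuRate B x p r) * μ (Set.Ici r) := by
        have h0 : menuRate B x p 0 = 0 := if_pos le_rfl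
        rw [h0, sub_zero, hc, ENNReal.ofReal_mul hrpos.le, ENNReal.ofReal_mul hrpos.le,
          ofReal_measureReal]
        ring

/-- The revenue of a menu is at most the welfare that it generates above the monopoly reserve. -/
theorem IsMenu.lintegral_pay_le (h : IsMenu T x p) (hp : Measurable p)
    (hr : IsMonopolyReserve μ r) (hT0 : ∀ t ∈ T, 0 ≤ t) (hT : ∀ᵐ t ∂μ, t ∈ T) :
    ∫⁻ t, ENNReal.ofReal (p t) ∂μ ≤ ∫⁻ t in Set.Ici r, ENNReal.ofReal (t * x t) ∂μ := by
  have hT' : ∀ᵐ t ∂(μ.restrict (Set.Ici r)), t ∈ T := ae_restrict_of_ae hT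
  -- Each type `t ≥ r` may imitate any type below `r`, so its utility is at least `r * menuRate r`,
  -- the amount that covers the payments from below.
  have hlow : ∫⁻ t in Set.Iio r, ENNReal.ofReal (p t) ∂μ ≤
      ∫⁻ t in Set.Ici r, ENNReal.ofReal (t * x t - p t) ∂μ := by
    rcases (T ∩ Set.Iio r).eq_empty_or_nonempty with hB | hB
    · refine (le_of_eq ?_).trans zero_le
      rw [Measure.restrict_zero_set, lintegral_zero_measure]
      rw [measure_eq_zero_iff_ae_notMem]
      filter_upwards [hT] with t ht htr
      exact (Set.eq_empty_iff_forall_notMem.1 hB) t ⟨ht, htr⟩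
    · have hrpos : 0 < r := by
        obtain ⟨b, hb⟩ := hB
        exact (hT0 b hb.1).trans_lt hb.2
      refine (h.lintegral_Iio_pay_le hp hr hT0 hT hB).trans ?_
      rw [← Measure.restrict_apply_univ, ← lintegral_const]
      refine lintegral_mono_ae ?_
      filter_upwards [hT', ae_restrict_mem measurableSet_Ici] with t ht htr
      refine ENNReal.ofReal_le_ofReal ?_
      rw [← le_div_iff₀' hrpos]
      refine menuRate_le hB hrpos fun b hb => ?_
      rw [le_div_iff₀' hrpos]
      have hu : 0 ≤ t * x t - p t := sub_nonneg.2 (h.pay_le t ht)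
      rcases max_cases 0 (x b - p b / r) with ⟨h1, -⟩ | ⟨h1, -⟩
      · rw [h1, mul_zero]
        exact hu
      · rw [h1, mul_sub, mul_div_cancel₀ _ hrpos.ne']
        have h2 := mul_le_mul_of_nonneg_right (Set.mem_Ici.1 htr) (h.alloc_nonneg b hb.1)
        linarith [h.incentive_compatible t ht b hb.1]
  have hsplit := lintegral_add_compl (μ := μ) (fun t => ENNReal.ofReal (p t))
    (measurableSet_Iio (a := r))
  rw [Set.compl_Iio] at hsplit
  rw [← hsplit]
  refine (add_le_add_left hlow _).trans_eq ?_
  rw [← lintegral_add_right _ hp.ennreal_ofReal]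
  refine lintegral_congr_ae ?_
  filter_upwards [hT'] with t ht
  rw [← ENNReal.ofReal_add (sub_nonneg.2 (h.pay_le t ht)) (h.pay_nonneg t ht), sub_add_cancel]

end Menu

/-! ### Optimal revenue against the welfare of the buyers above their reserves -/

section OptimalRevenue

variable {ι : Type*} [Fintype ι] [DecidableEq ι] {X : Finset (Finset ι)}

theorem sum_mul_le_of_mem_feasibleAllocations {a c : ι → ℝ} {m : ℝ}
    (ha : a ∈ feasibleAllocations X) (h : ∀ S ∈ X, ∑ i ∈ S, c i ≤ m) : ∑ i, c i * a i ≤ m := by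
  have hconv : Convex ℝ {a : ι → ℝ | ∑ i, c i * a i ≤ m} := by
    refine convex_halfSpace_le (f := fun a : ι → ℝ => ∑ i, c i * a i) ⟨fun x y => ?_, fun k x => ?_⟩ m
    · simp [mul_add, Finset.sum_add_distrib]
    · simp only [Pi.smul_apply, smul_eq_mul, Finset.mul_sum]
      exact Finset.sum_congr rfl fun i _ => by ring
  refine convexHull_min ?_ hconv ha
  rintro _ ⟨S, hS, rfl⟩
  simpa [Finset.sum_ite_mem] using h S hS

theorem mem_Icc_of_mem_feasibleAllocations {a : ι → ℝ} (ha : a ∈ feasibleAllocations X) (i : ι) :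
    a i ∈ Set.Icc (0 : ℝ) 1 := by
  have hconv : Convex ℝ {a : ι → ℝ | a i ∈ Set.Icc (0 : ℝ) 1} :=
    (convex_Icc (0 : ℝ) 1).linear_preimage (LinearMap.proj (R := ℝ) (φ := fun _ => ℝ) i)
  refine convexHull_min ?_ hconv ha
  rintro _ ⟨S, hS, rfl⟩
  by_cases hi : i ∈ S <;> simp [hi]

variable {μ : ι → Measure ℝ} {M : Mechanism ι}

/-- The expected allocation of buyer `i` when he reports `b`. -/
def Mechanism.interimAlloc (M : Mechanism ι) (μ : ι → Measure ℝ) (i : ι) (b : ℝ) : ℝ :=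
  ∫ v, M.alloc (Function.update v i b) i ∂(Measure.pi μ)

/-- The expected payment of buyer `i` when he reports `b`. -/
def Mechanism.interimPay (M : Mechanism ι) (μ : ι → Measure ℝ) (i : ι) (b : ℝ) : ℝ :=
  ∫ v, M.pay (Function.update v i b) i ∂(Measure.pi μ)

theorem support_subset_Ici {μ : Measure ℝ} (h : ∀ᵐ v ∂μ, 0 ≤ v) : μ.support ⊆ Set.Ici 0 :=
  Measure.support_subset_of_isClosed isClosed_Ici h

variable [∀ i, IsProbabilityMeasure (μ i)]

theorem Mechanism.IsAdmissible.integrable_alloc (hM : M.IsAdmissible X μ) (i : ι) (b : ℝ) :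
    Integrable (fun v => M.alloc (Function.update v i b) i) (Measure.pi μ) := by
  have hm : Measurable fun v => M.alloc (Function.update v i b) i :=
    (measurable_pi_apply i).comp (hM.measurable_alloc.comp measurable_update_left)
  refine Integrable.of_bound hm.aestronglyMeasurable 1 (ae_of_all _ fun v => ?_)
  have := mem_Icc_of_mem_feasibleAllocations (hM.feasible (Function.update v i b)) i
  rw [Real.norm_of_nonneg this.1]
  exact this.2

theorem Mechanism.IsAdmissible.interimUtility_eq (hM : M.IsAdmissible X μ) (i : ι) (t : ℝ) {b : ℝ}
    (hb : b ∈ (μ i).support) :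
    M.interimUtility μ i t b = t * M.interimAlloc μ i b - M.interimPay μ i b := by
  rw [interimUtility, integral_sub ((hM.integrable_alloc i b).const_mul t)
    (hM.integrable_pay i b hb), integral_const_mul, interimAlloc, interimPay]

theorem Mechanism.IsAdmissible.isMenu (hM : M.IsAdmissible X μ) (i : ι) :
    IsMenu (μ i).support (M.interimAlloc μ i) (M.interimPay μ i) where
  alloc_nonneg b _ := integral_nonneg fun v =>
    (mem_Icc_of_mem_feasibleAllocations (hM.feasible (Function.update v i b)) i).1
  alloc_le_one b _ := by
    refine (integral_mono (hM.integrable_alloc i b) (integrable_const 1) fun v =>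
      (mem_Icc_of_mem_feasibleAllocations (hM.feasible (Function.update v i b)) i).2).trans_eq ?_
    simp
  pay_nonneg b _ := integral_nonneg fun v => hM.pay_nonneg _ i
  pay_le t ht := by
    have := hM.individually_rational i t ht
    rw [hM.interimUtility_eq i t ht] at this
    linarith
  incentive_compatible t ht b hb := by
    have := hM.incentive_compatible i t ht b hb
    rwa [hM.interimUtility_eq i t ht, hM.interimUtility_eq i t hb] at this

/-- The menu bound is interim; Fubini turns it back into a bound on ex post allocations, to which
feasibility can be applied at each profile. -/
theorem Mechanism.IsAdmissible.lintegral_pay_le (hM : M.IsAdmissible X μ) (i : ι)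
    (h0 : ∀ᵐ v ∂(μ i), 0 ≤ v) {r : ℝ} (hr : IsMonopolyReserve (μ i) r) :
    ∫⁻ v, ENNReal.ofReal (M.pay v i) ∂(Measure.pi μ) ≤
      ∫⁻ v, ENNReal.ofReal ((if r ≤ v i then v i else 0) * M.alloc v i) ∂(Measure.pi μ) := by
  have hupd : Measurable fun z : (ι → ℝ) × ℝ => Function.update z.1 i z.2 := measurable_update'
  have hpay : Measurable fun v => M.pay v i := (measurable_pi_apply i).comp hM.measurable_pay
  have halloc : Measurable fun v => M.alloc v i := (measurable_pi_apply i).comp hM.measurable_alloc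
  have hval : Measurable fun v : ι → ℝ => if r ≤ v i then v i else 0 :=
    Measurable.ite (measurableSet_le measurable_const (measurable_pi_apply i))
      (measurable_pi_apply i) measurable_const
  have hsupp : ∀ᵐ t ∂(μ i), t ∈ (μ i).support := Measure.support_mem_ae
  have hpm : Measurable (M.interimPay μ i) :=
    ((hpay.comp hupd).comp measurable_swap).stronglyMeasurable.integral_prod_right'.measurable
  have hw : Measurable fun v => ENNReal.ofReal ((if r ≤ v i then v i else 0) * M.alloc v i) :=
    (hval.mul halloc).ennreal_ofReal
  rw [lintegral_pi_eq_lintegral_update μ i hpay.ennreal_ofReal,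
    lintegral_pi_eq_lintegral_update μ i hw,
    lintegral_lintegral_swap (f := fun v b => ENNReal.ofReal (M.pay (Function.update v i b) i))
      (hpay.ennreal_ofReal.comp hupd).aemeasurable,
    lintegral_lintegral_swap (f := fun v b => ENNReal.ofReal
      ((if r ≤ Function.update v i b i then Function.update v i b i else 0) *
        M.alloc (Function.update v i b) i)) (hw.comp hupd).aemeasurable]
  have h1 : ∫⁻ b, ∫⁻ v, ENNReal.ofReal (M.pay (Function.update v i b) i) ∂(Measure.pi μ) ∂(μ i) =
      ∫⁻ b, ENNReal.ofReal (M.interimPay μ i b) ∂(μ i) := by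
    refine lintegral_congr_ae ?_
    filter_upwards [hsupp] with b hb
    exact (ofReal_integral_eq_lintegral_ofReal (hM.integrable_pay i b hb)
      (ae_of_all _ fun v => hM.pay_nonneg _ i)).symm
  rw [h1]
  refine ((hM.isMenu i).lintegral_pay_le hpm hr (support_subset_Ici h0) hsupp).trans ?_
  rw [← lintegral_indicator measurableSet_Ici]
  refine lintegral_mono fun b => ?_
  by_cases hb : r ≤ b
  · simp only [Set.indicator_of_mem (Set.mem_Ici.2 hb), Function.update_self, if_pos hb]
    have hb0 : 0 ≤ b := hr.1.trans hb
    simp_rw [ENNReal.ofReal_mul hb0]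
    rw [lintegral_const_mul' _ _ ENNReal.ofReal_ne_top]
    refine mul_le_mul_right (le_of_eq ?_) _
    exact ofReal_integral_eq_lintegral_ofReal (hM.integrable_alloc i b)
      (ae_of_all _ fun v => (mem_Icc_of_mem_feasibleAllocations (hM.feasible _) i).1)
  · rw [Set.indicator_of_notMem (by simpa using hb)]
    exact zero_le

theorem optimalRevenue_le_lintegral_welfare (hX : IsDownwardClosed X)
    (h0 : ∀ i, ∀ᵐ v ∂(μ i), 0 ≤ v) {r : ι → ℝ} (hr : ∀ i, IsMonopolyReserve (μ i) (r i))
    {w : (ι → ℝ) → Finset ι} (hw : IsEagerRule X r w) :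
    optimalRevenue X μ ≤ ∫⁻ v, ENNReal.ofReal (welfare v (w v)) ∂(Measure.pi μ) := by
  refine iSup₂_le fun M hM => ?_
  have hval : ∀ i (v : ι → ℝ), 0 ≤ if r i ≤ v i then v i else 0 := fun i v => by
    split_ifs with h
    · exact (hr i).1.trans h
    · exact le_rfl
  have hm : ∀ i, Measurable fun v : ι → ℝ => (if r i ≤ v i then v i else 0) * M.alloc v i :=
    fun i => (Measurable.ite (measurableSet_le measurable_const (measurable_pi_apply i))
      (measurable_pi_apply i) measurable_const).mul
      ((measurable_pi_apply i).comp hM.measurable_alloc)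
  have hpay : ∀ i, Measurable fun v => M.pay v i := fun i =>
    (measurable_pi_apply i).comp hM.measurable_pay
  rw [Mechanism.revenue, lintegral_finsetSum _ fun i _ => (hpay i).ennreal_ofReal]
  refine (Finset.sum_le_sum fun i _ => hM.lintegral_pay_le i (h0 i) (hr i)).trans ?_
  rw [← lintegral_finsetSum _ fun i _ => (hm i).ennreal_ofReal]
  refine lintegral_mono fun v => ?_
  have ha := hM.feasible v
  rw [← ENNReal.ofReal_sum_of_nonneg fun i _ =>
    mul_nonneg (hval i v) (mem_Icc_of_mem_feasibleAllocations ha i).1]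
  refine ENNReal.ofReal_le_ofReal (sum_mul_le_of_mem_feasibleAllocations ha fun S hS => ?_)
  -- Dropping the members below their reserves leaves, by downward closure, a set that competes in
  -- the eager auction.
  rw [← Finset.sum_filter]
  refine hw.optimal v _ ?_
  rw [eagerFamily, Finset.mem_filter]
  exact ⟨hX.2 S hS _ (Finset.filter_subset _ _), fun i hi => (Finset.mem_filter.1 hi).2⟩

theorem optimalRevenue_le_optimalWelfare (hX : IsDownwardClosed X)
    (h0 : ∀ i, ∀ᵐ v ∂(μ i), 0 ≤ v) {r : ι → ℝ} (hr : ∀ i, IsMonopolyReserve (μ i) (r i)) :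
    optimalRevenue X μ ≤ optimalWelfare X μ := by
  obtain ⟨w, hw⟩ := exists_isEagerRule X hX r
  refine (optimalRevenue_le_lintegral_welfare hX h0 hr hw).trans ?_
  exact lintegral_mono fun v => ENNReal.ofReal_le_ofReal
    (le_maxWelfare v (Finset.mem_filter.1 (hw.mem v)).1)

theorem ofReal_welfare_le (v : ι → ℝ) (S : Finset ι) :
    ENNReal.ofReal (welfare v S) ≤ ∑ i ∈ S, ENNReal.ofReal (v i) :=
  Finset.le_sum_of_subadditive _ ENNReal.ofReal_zero.le (fun _ _ => ENNReal.ofReal_add_le) S v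

theorem ofReal_one_div_mul_le {k : ℝ} (hk : 0 < k) {a b : ENNReal} (h : a ≤ ENNReal.ofReal k * b) :
    ENNReal.ofReal (1 / k) * a ≤ b := by
  refine (mul_le_mul_right h _).trans_eq ?_
  rw [← mul_assoc, ← ENNReal.ofReal_mul (by positivity), one_div_mul_cancel hk.ne',
    ENNReal.ofReal_one, one_mul]

variable {r : ι → ℝ} {w : (ι → ℝ) → Finset ι}

/-- Eager monopoly reserves guarantee a `1 / (e + 1)` fraction of the optimal revenue. -/
theorem optimalRevenue_le_eagerRevenue (hX : IsDownwardClosed X) (hμ : ∀ i, IsQuasiMHR (μ i))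
    (hr : ∀ i, IsMonopolyReserve (μ i) (r i)) (hw : IsEagerRule X r w) :
    ENNReal.ofReal (1 / (Real.exp 1 + 1)) * optimalRevenue X μ ≤ eagerRevenue X μ r w := by
  refine ofReal_one_div_mul_le (by positivity) ?_
  refine (optimalRevenue_le_lintegral_welfare hX (fun i => (hμ i).nonneg) hr hw).trans ?_
  refine (lintegral_mono fun v => ofReal_welfare_le v (w v)).trans ?_
  refine (IsWinnerRule.lintegral_welfare_le hX (isScreenedFamily_eagerFamily X r) hw μ hμ hr
    (fun i => measurableSet_Ici) (fun i x h => h)).trans_eq ?_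
  rw [eagerRevenue]
  congr 1
  refine lintegral_congr fun v => ?_
  rw [Finset.filter_true_of_mem (Finset.mem_filter.1 (hw.mem v)).2]

/-- Lazy monopoly reserves guarantee a `1 / (e + 1)` fraction of the optimal welfare. -/
theorem optimalWelfare_le_lazyRevenue (hX : IsDownwardClosed X) (hμ : ∀ i, IsQuasiMHR (μ i))
    (hr : ∀ i, IsMonopolyReserve (μ i) (r i)) (hw : IsLazyRule X w) :
    ENNReal.ofReal (1 / (Real.exp 1 + 1)) * optimalWelfare X μ ≤ lazyRevenue X μ r w := by
  refine ofReal_one_div_mul_le (by positivity) ?_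
  refine (lintegral_mono fun v => ?_).trans
    (IsWinnerRule.lintegral_welfare_le hX (isScreenedFamily_const X) hw μ hμ hr
      (fun i => MeasurableSet.const _) (fun i x h => trivial))
  refine (ENNReal.ofReal_le_ofReal ?_).trans (ofReal_welfare_le v (w v))
  exact maxWelfare_le hX.1 (hw.optimal v)

end OptimalRevenue

/-! ### Extremal value distributions -/

theorem real_Ioi_expMeasure {c : ℝ} (hc : 0 < c) {s : ℝ} (hs : 0 ≤ s) :
    (expMeasure c).real (Set.Ioi s) = Real.exp (-(c * s)) := by
  have := isProbabilityMeasure_expMeasure hc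
  rw [← one_sub_cdf, cdf_expMeasure_eq hc, if_pos hs, sub_sub_cancel]

theorem real_Ici_expMeasure {c : ℝ} (hc : 0 < c) {s : ℝ} (hs : 0 ≤ s) :
    (expMeasure c).real (Set.Ici s) = Real.exp (-(c * s)) := by
  have hac : expMeasure c ≪ volume := withDensity_absolutelyContinuous _ _
  rw [← real_Ioi_expMeasure hc hs]
  exact measureReal_congr (hac.ae_eq Ioi_ae_eq_Ici.symm)

/-- An exponential value of rate `c`, truncated to `[1, M]`. -/
def truncExp (c M : ℝ) : Measure ℝ := (expMeasure c).map fun x => max 1 (min M x)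

section TruncExp

variable {c M : ℝ}

theorem measurable_trunc (M : ℝ) : Measurable fun x : ℝ => max 1 (min M x) := by fun_prop

theorem isProbabilityMeasure_truncExp (hc : 0 < c) (M : ℝ) :
    IsProbabilityMeasure (truncExp c M) := by
  have := isProbabilityMeasure_expMeasure hc
  exact Measure.isProbabilityMeasure_map (measurable_trunc M).aemeasurable

theorem ae_truncExp_mem_Icc (c : ℝ) (hM : 1 ≤ M) : ∀ᵐ v ∂(truncExp c M), v ∈ Set.Icc 1 M :=
  (ae_map_iff (measurable_trunc M).aemeasurable measurableSet_Icc).2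
    (ae_of_all _ fun _ => ⟨le_max_left _ _, max_le hM (min_le_left _ _)⟩)

theorem real_Ioi_truncExp_of_lt_one (hc : 0 < c) {s : ℝ} (hs : s < 1) :
    (truncExp c M).real (Set.Ioi s) = 1 := by
  have := isProbabilityMeasure_expMeasure hc
  rw [truncExp, map_measureReal_apply (measurable_trunc M) measurableSet_Ioi]
  convert! probReal_univ (μ := expMeasure c)
  ext x
  simp [hs]

theorem real_Ioi_truncExp (hc : 0 < c) {s : ℝ} (hs : 1 ≤ s) (hsM : s < M) :
    (truncExp c M).real (Set.Ioi s) = Real.exp (-(c * s)) := by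
  rw [truncExp, map_measureReal_apply (measurable_trunc M) measurableSet_Ioi,
    ← real_Ioi_expMeasure hc (zero_le_one.trans hs)]
  congr 1
  ext x
  simp [hs.not_gt, hsM]

theorem real_Ioi_truncExp_of_le (hM : 1 ≤ M) {s : ℝ} (hs : M ≤ s) :
    (truncExp c M).real (Set.Ioi s) = 0 := by
  rw [truncExp, map_measureReal_apply (measurable_trunc M) measurableSet_Ioi]
  convert! measureReal_empty (μ := expMeasure c)
  ext x
  simp [hs.not_gt, (hM.trans hs).not_gt]

theorem real_Ici_truncExp_le (hc : 0 < c) {s : ℝ} (hs : 1 < s) :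
    (truncExp c M).real (Set.Ici s) ≤ Real.exp (-(c * s)) := by
  have := isProbabilityMeasure_expMeasure hc
  rw [truncExp, map_measureReal_apply (measurable_trunc M) measurableSet_Ici,
    ← real_Ici_expMeasure hc (zero_lt_one.trans hs).le]
  refine measureReal_mono fun x hx => ?_
  have hx' : s ≤ 1 ∨ s ≤ M ∧ s ≤ x := by simpa using hx
  exact (hx'.resolve_left hs.not_ge).2

/-- The rate is `0` below `1` and constantly `c` on `[1, M)`; from `M` on nothing is required. -/
theorem isQuasiMHR_truncExp (hc : 0 < c) (hM : 1 ≤ M) : IsQuasiMHR (truncExp c M) := by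
  have := isProbabilityMeasure_truncExp hc M
  refine ⟨(ae_truncExp_mem_Icc c hM).mono fun v hv => zero_le_one.trans hv.1, ?_⟩
  rintro s ⟨hs0, hs⟩ t ⟨ht0, ht⟩ hst
  have hcdf : ∀ v, cdf (truncExp c M) v < 1 → v < M := fun v hv => by
    by_contra hc'
    have h1 := one_sub_cdf (truncExp c M) v
    rw [real_Ioi_truncExp_of_le hM (not_lt.1 hc')] at h1
    linarith
  have hrate : ∀ v, 1 ≤ v → v < M →
      -Real.log ((truncExp c M).real (Set.Ioi v)) / v = c := fun v hv hvM => by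
    have : v ≠ 0 := (zero_lt_one.trans_le hv).ne'
    rw [real_Ioi_truncExp hc hv hvM, Real.log_exp, neg_neg, mul_div_cancel_right₀ _ this]
  simp only [one_sub_cdf]
  rcases lt_or_ge s 1 with hs1 | hs1
  · rw [real_Ioi_truncExp_of_lt_one hc hs1, Real.log_one, neg_zero, zero_div]
    exact div_nonneg (neg_nonneg.2 (Real.log_nonpos measureReal_nonneg measureReal_le_one)) ht0.le
  · rw [hrate s hs1 (hcdf s hs), hrate t (hs1.trans hst) (hcdf t ht)]

theorem real_Ici_truncExp_of_le_one (hc : 0 < c) {s : ℝ} (hs : s ≤ 1) :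
    (truncExp c M).real (Set.Ici s) = 1 := by
  have := isProbabilityMeasure_expMeasure hc
  rw [truncExp, map_measureReal_apply (measurable_trunc M) measurableSet_Ici]
  convert! probReal_univ (μ := expMeasure c)
  ext x
  simp [hs]

/-- If a reserve earns strictly more than every other price, it is the unique monopoly reserve. -/
theorem isMonopolyReserve_iff_of_lt {μ : Measure ℝ} {r : ℝ} (hr : 0 ≤ r)
    (h : ∀ p, 0 ≤ p → p ≠ r → p * μ.real (Set.Ici p) < r * μ.real (Set.Ici r)) (p : ℝ) :
    IsMonopolyReserve μ p ↔ p = r := by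
  constructor
  · intro hp
    by_contra hne
    exact (h p hp.1 hne).not_ge (hp.2 r hr)
  · rintro rfl
    refine ⟨hr, fun s hs => ?_⟩
    rcases eq_or_ne s p with rfl | hne
    · exact le_rfl
    · exact (h s hs hne).le

/-- Since `x * exp (-x) ≤ 1 / e`, a price above `1` earns at most `1 / (e * c)`, which is below `1`
when `c > 1 / e`. At the limiting rate `1 / e` the price `e` could tie. -/
theorem isMonopolyReserve_truncExp_iff (hc : Real.exp (-1) < c) (p : ℝ) :
    IsMonopolyReserve (truncExp c M) p ↔ p = 1 := by
  have hc0 : 0 < c := (Real.exp_pos _).trans hc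
  refine isMonopolyReserve_iff_of_lt zero_le_one (fun s hs0 hs => ?_) p
  rw [real_Ici_truncExp_of_le_one hc0 le_rfl, mul_one]
  rcases hs.lt_or_gt with h | h
  · rwa [real_Ici_truncExp_of_le_one hc0 h.le, mul_one]
  · refine (mul_le_mul_of_nonneg_left (real_Ici_truncExp_le hc0 h) hs0).trans_lt ?_
    have h1 : c * s * Real.exp (-(c * s)) ≤ Real.exp (-1) := by
      have := Real.add_one_le_exp (c * s - 1)
      calc c * s * Real.exp (-(c * s)) ≤ Real.exp (c * s - 1) * Real.exp (-(c * s)) := by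
            gcongr
            linarith
        _ = Real.exp (-1) := by rw [← Real.exp_add]; ring_nf
    by_contra hcon
    push Not at hcon
    have := mul_le_mul_of_nonneg_left hcon hc0.le
    linarith

theorem lintegral_Ioi_one_truncExp (hc : 0 < c) (hM : 1 < M) :
    ∫⁻ v in Set.Ioi 1, ENNReal.ofReal v ∂(truncExp c M) =
      ENNReal.ofReal (Real.exp (-c) * (1 + 1 / c) - Real.exp (-(c * M)) / c) := by
  have := isProbabilityMeasure_truncExp hc M
  have h1 : ∫⁻ s in Set.Ioi 0, truncExp c M (Set.Ioi (1 + s)) =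
      ∫⁻ s in Set.Ioc 0 (M - 1), ENNReal.ofReal (Real.exp (-c) * Real.exp (-c * s)) := by
    rw [← lintegral_indicator measurableSet_Ioi, ← lintegral_indicator measurableSet_Ioc]
    -- At `s = M - 1` the tail has already dropped to `0` while the closed interval still counts the
    -- exponential; this point is null.
    have hne : ∀ᵐ s : ℝ, s ≠ M - 1 := by simp [ae_iff]
    refine lintegral_congr_ae ?_
    filter_upwards [hne] with s hsne
    by_cases hs0 : 0 < s
    · rw [Set.indicator_of_mem (Set.mem_Ioi.2 hs0), ← ofReal_measureReal]
      rcases hsne.lt_or_gt with h | h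
      · rw [Set.indicator_of_mem (show s ∈ Set.Ioc 0 (M - 1) from ⟨hs0, h.le⟩), real_Ioi_truncExp hc (by linarith) (by linarith),
          ← Real.exp_add]
        ring_nf
      · rw [Set.indicator_of_notMem fun h' => h.not_ge h'.2,
          real_Ioi_truncExp_of_le hM.le (by linarith), ENNReal.ofReal_zero]
    · rw [Set.indicator_of_notMem (by simpa using hs0),
        Set.indicator_of_notMem fun h' => hs0 h'.1]
  have hint : IntervalIntegrable (fun s => Real.exp (-c) * Real.exp (-c * s)) volume 0 (M - 1) :=
    (by fun_prop : Continuous fun s => Real.exp (-c) * Real.exp (-c * s)).intervalIntegrable _ _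
  have hval : ∫ s in (0 : ℝ)..(M - 1), Real.exp (-c) * Real.exp (-c * s) =
      Real.exp (-c) * (1 / c) - Real.exp (-(c * M)) / c := by
    have h2 : Real.exp (-(c * M)) = Real.exp (-c) * Real.exp (-c * (M - 1)) := by
      rw [← Real.exp_add]
      ring_nf
    rw [intervalIntegral.integral_eq_sub_of_hasDerivAt
      (f := fun s => -(Real.exp (-c) * (Real.exp (-c * s) / c))) (fun s _ => ?_) hint, h2]
    · simp only [mul_zero, Real.exp_zero]
      ring
    · have h3 : HasDerivAt (fun s : ℝ => -c * s) (-c) s := by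
        simpa using (hasDerivAt_id s).const_mul (-c)
      convert! ((h3.exp.div_const c).const_mul (Real.exp (-c))).neg using 1
      field_simp
  have h0 : 0 ≤ ∫ s in (0 : ℝ)..(M - 1), Real.exp (-c) * Real.exp (-c * s) :=
    intervalIntegral.integral_nonneg (by linarith) fun s _ => by positivity
  rw [lintegral_Ioi_eq _ zero_le_one, h1, ← ofReal_measureReal,
    real_Ioi_truncExp hc le_rfl hM, ENNReal.ofReal_one, one_mul, mul_one,
    ← ofReal_integral_eq_lintegral_ofReal
      ((intervalIntegrable_iff_integrableOn_Ioc_of_le (by linarith)).1 hint)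
      (ae_of_all _ fun s => by positivity),
    ← intervalIntegral.integral_of_le (by linarith), ← ENNReal.ofReal_add (Real.exp_pos _).le h0,
    hval]
  congr 1
  ring

end TruncExp

section Dirac

variable {b : ℝ}

theorem isQuasiMHR_dirac (hb : 0 ≤ b) : IsQuasiMHR (Measure.dirac b) := by
  refine ⟨(ae_dirac_iff measurableSet_Ici).2 hb, ?_⟩
  have hzero : ∀ v, cdf (Measure.dirac b) v < 1 → -Real.log (1 - cdf (Measure.dirac b) v) / v = 0 := by
    intro v hv
    have : cdf (Measure.dirac b) v = 0 := by
      rw [cdf_eq_real] at hv ⊢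
      by_cases h : b ≤ v
      · simp [measureReal_def, h] at hv
      · simp [measureReal_def, h]
    simp [this]
  rintro s ⟨-, hs⟩ t ⟨-, ht⟩ -
  exact ((hzero s hs).trans (hzero t ht).symm).le

theorem isMonopolyReserve_dirac_iff (hb : 0 < b) (p : ℝ) :
    IsMonopolyReserve (Measure.dirac b) p ↔ p = b := by
  refine isMonopolyReserve_iff_of_lt hb.le (fun s _ hs => ?_) p
  rcases hs.lt_or_gt with h | h
  · simpa [measureReal_def, h.le] using h
  · simpa [measureReal_def, h.not_ge] using hb

end Dirac

/-! ### A single large buyer against a multi-unit auction -/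

section Game

variable {ι : Type*} [Fintype ι] [DecidableEq ι]

/-- Either serve the buyer `z` alone, or at most `k` of the other buyers. -/
def rivalFamily (z : ι) (k : ℕ) : Finset (Finset ι) :=
  Finset.univ.filter fun S => S = {z} ∨ (z ∉ S ∧ S.card ≤ k)

theorem mem_rivalFamily {z : ι} {k : ℕ} {S : Finset ι} :
    S ∈ rivalFamily z k ↔ S = {z} ∨ (z ∉ S ∧ S.card ≤ k) := by simp [rivalFamily]

theorem isDownwardClosed_rivalFamily (z : ι) (k : ℕ) : IsDownwardClosed (rivalFamily z k) := by
  refine ⟨⟨{z}, mem_rivalFamily.2 (Or.inl rfl)⟩, fun S hS T hTS => ?_⟩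
  rw [mem_rivalFamily] at hS ⊢
  rcases hS with rfl | ⟨hz, hk⟩
  · rcases Finset.subset_singleton_iff.1 hTS with rfl | rfl
    · exact Or.inr (by simp)
    · exact Or.inl rfl
  · exact Or.inr ⟨fun h => hz (hTS h), (Finset.card_le_card hTS).trans hk⟩

variable {z : ι} {k : ℕ} {v : ι → ℝ} {b M : ℝ} {W : Finset ι}

theorem welfare_rivalFamily_le (hb : 0 ≤ b) (hM : 1 ≤ M) (hz : v z = b)
    (hv : ∀ i, i ≠ z → v i ∈ Set.Icc 1 M) (hW : W ∈ rivalFamily z k) :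
    welfare v W ≤ b + k * M := by
  rcases mem_rivalFamily.1 hW with rfl | ⟨hzW, hk⟩
  · have : 0 ≤ k * M := by positivity
    simpa [welfare, hz] using this
  · have h1 : welfare v W ≤ W.card • M :=
      Finset.sum_le_card_nsmul W v M fun i hi => (hv i (ne_of_mem_of_not_mem hi hzW)).2
    have h2 : (W.card : ℝ) * M ≤ k * M := by gcongr
    rw [nsmul_eq_mul] at h1
    linarith

/-- With individual prices at most the values, revenue is at most welfare. -/
theorem sum_max_vcgPayment_le_welfare {X : Finset (Finset ι)} (hX : IsDownwardClosed X)
    (hopt : ∀ S ∈ X, welfare v S ≤ welfare v W) {r : ι → ℝ} (hr : ∀ i, r i ≤ v i) :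
    ∑ i ∈ W, max (r i) (vcgPayment X v W i) ≤ welfare v W := by
  refine Finset.sum_le_sum fun i hi => max_le (hr i) ?_
  have h1 : maxWelfare (X.filter (fun S => i ∉ S)) v ≤ welfare v W :=
    maxWelfare_le ⟨∅, by simp [hX.empty_mem]⟩ fun S hS => hopt S (Finset.mem_filter.1 hS).1
  rw [vcgPayment, ← add_welfare_erase v hi] at *
  linarith

/-- If fewer than `k` of the small buyers are above the reserve `1` and together they beat the large
buyer by a margin, then at most `k` buyers win, and they pay `1` each. -/
theorem sum_max_vcgPayment_le_card (hM : 1 ≤ M) (hz : v z = b)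
    (hv : ∀ i, i ≠ z → v i ∈ Set.Icc 1 M) (hW : W ∈ rivalFamily z k)
    (hopt : ∀ S ∈ rivalFamily z k, welfare v S ≤ welfare v W) {r : ι → ℝ}
    (hr : ∀ i, i ≠ z → r i = 1)
    (hcard : ((Finset.univ.erase z).filter fun i => 1 < v i).card < k)
    (hsum : b + M ≤ ∑ i ∈ (Finset.univ.erase z).filter (fun i => 1 < v i), v i) :
    ∑ i ∈ W, max (r i) (vcgPayment (rivalFamily z k) v W i) ≤ k := by
  set H := (Finset.univ.erase z).filter fun i => 1 < v i with hH
  have hzH : z ∉ H := by simp [hH]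
  have hWz : z ∉ W ∧ W.card ≤ k := by
    refine (mem_rivalFamily.1 hW).resolve_left ?_
    rintro rfl
    have h1 := hopt H (mem_rivalFamily.2 (Or.inr ⟨hzH, hcard.le⟩))
    simp only [welfare, Finset.sum_singleton, hz] at h1
    linarith
  have hpos : ∀ i, i ≠ z → 0 ≤ v i := fun i hi => zero_le_one.trans (hv i hi).1
  have hone : ∀ i ∈ W, max (r i) (vcgPayment (rivalFamily z k) v W i) ≤ 1 := by
    intro i hi
    have hiz : i ≠ z := ne_of_mem_of_not_mem hi hWz.1
    have hsmall : ∀ S : Finset ι, z ∉ S → i ∉ S → S.card < k →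
        welfare v S ≤ welfare v (W.erase i) := by
      intro S hzS hiS hSk
      have h1 := hopt (insert i S) (mem_rivalFamily.2 (Or.inr
        ⟨by simp [hiz.symm, hzS], (Finset.card_insert_of_notMem hiS).trans_le hSk⟩))
      rw [← add_welfare_erase v hi, welfare, Finset.sum_insert hiS] at h1
      exact le_of_add_le_add_left h1
    refine max_le (hr i hiz).le ?_
    rw [vcgPayment, sub_le_iff_le_add]
    refine maxWelfare_le ⟨∅, by simp [mem_rivalFamily]⟩ fun S hS => ?_
    obtain ⟨hSX, hiS⟩ := Finset.mem_filter.1 hS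
    -- The externality of `i` is at most `1`. Against `{z}`, the margin `M` absorbs the loss of `i`
    -- from `H`. Against a full set of `k` small buyers, one member lies outside `H` and hence has
    -- value at most `1`; removing him leaves room for `i`.
    rcases mem_rivalFamily.1 hSX with rfl | ⟨hzS, hSk⟩
    · have h1 := hsmall (H.erase i) (fun h => hzH (Finset.mem_of_mem_erase h))
        (Finset.notMem_erase i H) ((Finset.card_le_card (Finset.erase_subset i H)).trans_lt hcard)
      have h2 : ∑ j ∈ H, v j ≤ welfare v (H.erase i) + M := by
        by_cases hiH : i ∈ H
        · have := add_welfare_erase v hiH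
          rw [welfare, welfare] at *
          linarith [(hv i hiz).2]
        · rw [Finset.erase_eq_of_notMem hiH, welfare]
          linarith
      simp only [welfare, Finset.sum_singleton, hz] at h1 h2 ⊢
      linarith
    · rcases hSk.lt_or_eq with hlt | heq
      · linarith [hsmall S hzS hiS hlt]
      · obtain ⟨j, hjS, hjH⟩ : ∃ j ∈ S, j ∉ H := by
          by_contra hcon
          push Not at hcon
          exact absurd (Finset.card_le_card (fun j hj => hcon j hj : S ⊆ H)) (by omega)
        have hjz : j ≠ z := ne_of_mem_of_not_mem hjS hzS
        have hj1 : v j ≤ 1 := by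
          by_contra hcon
          exact hjH (by simp [hH, hjz, not_le.1 hcon])
        have h1 := hsmall (S.erase j) (fun h => hzS (Finset.mem_of_mem_erase h))
          (fun h => hiS (Finset.mem_of_mem_erase h))
          (by rw [Finset.card_erase_of_mem hjS]
              have := Finset.card_pos.2 ⟨j, hjS⟩
              omega)
        rw [← add_welfare_erase v hjS]
        linarith
  calc _ ≤ W.card • (1 : ℝ) := Finset.sum_le_card_nsmul W _ 1 hone
    _ ≤ k := by simpa using hWz.2

/-! ### Revenue in the game with random values -/

/-- The large buyer has value `b`, the others have truncated exponential values. -/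
def rivalMeasure (z : ι) (b c M : ℝ) (i : ι) : Measure ℝ :=
  if i = z then Measure.dirac b else truncExp c M

/-- The monopoly reserves: `b` for the large buyer, `1` for the others. -/
def rivalReserve (z : ι) (b : ℝ) (i : ι) : ℝ := if i = z then b else 1

variable {c : ℝ}

theorem isProbabilityMeasure_rivalMeasure (z : ι) (b : ℝ) (hc : 0 < c) (M : ℝ) (i : ι) :
    IsProbabilityMeasure (rivalMeasure z b c M i) := by
  rw [rivalMeasure]
  split_ifs
  · infer_instance
  · exact isProbabilityMeasure_truncExp hc M

theorem isQuasiMHR_rivalMeasure (z : ι) (hb : 0 ≤ b) (hc : 0 < c) (hM : 1 ≤ M) (i : ι) :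
    IsQuasiMHR (rivalMeasure z b c M i) := by
  rw [rivalMeasure]
  split_ifs
  · exact isQuasiMHR_dirac hb
  · exact isQuasiMHR_truncExp hc hM

theorem isMonopolyReserve_rivalMeasure_iff (z : ι) (hb : 0 < b) (hc : Real.exp (-1) < c) (i : ι)
    (p : ℝ) : IsMonopolyReserve (rivalMeasure z b c M i) p ↔ p = rivalReserve z b i := by
  rw [rivalMeasure, rivalReserve]
  split_ifs
  · exact isMonopolyReserve_dirac_iff hb p
  · exact isMonopolyReserve_truncExp_iff hc p

theorem ae_rivalMeasure (z : ι) (b : ℝ) (hc : 0 < c) (hM : 1 ≤ M) :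
    ∀ᵐ v ∂(Measure.pi (rivalMeasure z b c M)), v z = b ∧ ∀ i, i ≠ z → v i ∈ Set.Icc 1 M := by
  have := isProbabilityMeasure_rivalMeasure z b hc M
  have hq := fun i =>
    (measurePreserving_eval (rivalMeasure z b c M) i).quasiMeasurePreserving
  have h1 : ∀ᵐ x ∂(rivalMeasure z b c M z), x = b := by
    rw [rivalMeasure, if_pos rfl]
    exact (ae_dirac_iff (measurableSet_singleton b)).2 rfl
  have h2 : ∀ i, i ≠ z → ∀ᵐ x ∂(rivalMeasure z b c M i), x ∈ Set.Icc 1 M := fun i hi => by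
    rw [rivalMeasure, if_neg hi]
    exact ae_truncExp_mem_Icc c hM
  have h3 : ∀ᵐ v ∂(Measure.pi (rivalMeasure z b c M)), ∀ i, i ≠ z → v i ∈ Set.Icc 1 M := by
    rw [ae_all_iff]
    intro i
    rw [Filter.eventually_imp_distrib_left]
    exact fun hi => (hq i).ae (h2 i hi)
  exact ((hq z).ae h1).and h3

/-- Selling to the large buyer only yields the revenue `b`. -/
theorem ofReal_le_optimalRevenue_rivalFamily (z : ι) (k : ℕ) (hb : 0 ≤ b) (hc : 0 < c) :
    ENNReal.ofReal b ≤ optimalRevenue (rivalFamily z k) (rivalMeasure z b c M) := by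
  have := isProbabilityMeasure_rivalMeasure z b hc M
  let A : Mechanism ι :=
    ⟨fun _ i => if i ∈ ({z} : Finset ι) then 1 else 0, fun _ i => if i = z then b else 0⟩
  have hutil : ∀ i t s, t ∈ (rivalMeasure z b c M i).support →
      A.interimUtility (rivalMeasure z b c M) i t s = 0 := by
    intro i t s ht
    by_cases hi : i = z
    · have hsub : (rivalMeasure z b c M i).support ⊆ {b} := by
        refine Measure.support_subset_of_isClosed isClosed_singleton ?_
        rw [rivalMeasure, if_pos hi]
        exact (ae_dirac_iff (measurableSet_singleton b)).2 rfl
      have htb : t = b := hsub ht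
      simp [Mechanism.interimUtility, A, hi, htb]
    · simp [Mechanism.interimUtility, A, hi]
  have hA : A.IsAdmissible (rivalFamily z k) (rivalMeasure z b c M) :=
    { measurable_alloc := measurable_const
      measurable_pay := measurable_const
      feasible := fun _ => subset_convexHull ℝ _ ⟨{z}, by simp [mem_rivalFamily], rfl⟩
      pay_nonneg := fun _ i => by
        by_cases hi : i = z <;> simp [A, hi, hb]
      integrable_pay := fun i _ _ => integrable_const _
      incentive_compatible := fun i t ht s _ => by rw [hutil i t s ht, hutil i t t ht]
      individually_rational := fun i t ht => (hutil i t t ht).ge }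
  refine le_trans ?_ (le_iSup₂ (f := fun (M' : Mechanism ι) (_ : M'.IsAdmissible (rivalFamily z k)
    (rivalMeasure z b c M)) => M'.revenue (rivalMeasure z b c M)) A hA)
  have : ∀ i, ENNReal.ofReal (if i = z then b else 0) = if i = z then ENNReal.ofReal b else 0 :=
    fun i => by split_ifs <;> simp
  simp [Mechanism.revenue, A, this]

/-- The profiles at which the auction among the small buyers need not clear at the price `1`. -/
def rivalBadSet (z : ι) (k : ℕ) (b M : ℝ) : Set (ι → ℝ) :=
  {v | k ≤ ((Finset.univ.erase z).filter fun i => 1 < v i).card} ∪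
    {v | ∑ i ∈ (Finset.univ.erase z).filter (fun i => 1 < v i), v i < b + M}

theorem measurableSet_rivalBadSet (z : ι) (k : ℕ) (b M : ℝ) :
    MeasurableSet (rivalBadSet z k b M) := by
  have h1 : ∀ i : ι, MeasurableSet {v : ι → ℝ | 1 < v i} := fun i =>
    measurableSet_lt measurable_const (measurable_pi_apply i)
  refine MeasurableSet.union ?_ ?_
  · simp_rw [Finset.card_filter]
    exact measurableSet_le measurable_const (Finset.measurable_sum _ fun i _ =>
      Measurable.ite (h1 i) measurable_const measurable_const)
  · simp_rw [Finset.sum_filter]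
    exact measurableSet_lt (Finset.measurable_sum _ fun i _ =>
      Measurable.ite (h1 i) (measurable_pi_apply i) measurable_const) measurable_const

/-- A revenue that is dominated, at almost every profile, by that of some VCG outcome is at most
`k` plus a contribution of the bad set. -/
theorem lintegral_rival_le (hb : 0 ≤ b) (hc : 0 < c) (hM : 1 ≤ M) {f : (ι → ℝ) → ENNReal}
    (hf : ∀ v, v z = b → (∀ i, i ≠ z → v i ∈ Set.Icc 1 M) →
      ∃ W ∈ rivalFamily z k, (∀ S ∈ rivalFamily z k, welfare v S ≤ welfare v W) ∧
        f v ≤ ∑ i ∈ W, ENNReal.ofReal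
          (max (rivalReserve z b i) (vcgPayment (rivalFamily z k) v W i))) :
    ∫⁻ v, f v ∂(Measure.pi (rivalMeasure z b c M)) ≤
      k + ENNReal.ofReal (b + k * M) *
        Measure.pi (rivalMeasure z b c M) (rivalBadSet z k b M) := by
  have := isProbabilityMeasure_rivalMeasure z b hc M
  have hr0 : ∀ i, 0 ≤ rivalReserve z b i := fun i => by
    rw [rivalReserve]
    split_ifs
    · exact hb
    · exact zero_le_one
  have hbound : ∀ᵐ v ∂(Measure.pi (rivalMeasure z b c M)), f v ≤
      k + (rivalBadSet z k b M).indicator (fun _ => ENNReal.ofReal (b + k * M)) v := by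
    filter_upwards [ae_rivalMeasure z b hc hM] with v ⟨hz, hv⟩
    obtain ⟨W, hW, hopt, hle⟩ := hf v hz hv
    refine hle.trans ?_
    rw [← ENNReal.ofReal_sum_of_nonneg fun i _ => le_max_of_le_left (hr0 i)]
    by_cases hbad : v ∈ rivalBadSet z k b M
    · rw [Set.indicator_of_mem hbad]
      refine le_add_left (ENNReal.ofReal_le_ofReal ?_)
      refine (sum_max_vcgPayment_le_welfare (isDownwardClosed_rivalFamily z k) hopt ?_).trans
        (welfare_rivalFamily_le hb hM hz hv hW)
      intro i
      rw [rivalReserve]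
      split_ifs with hi
      · rw [hi, hz]
      · exact (hv i hi).1
    · rw [Set.indicator_of_notMem hbad, add_zero, ← ENNReal.ofReal_natCast]
      simp only [rivalBadSet, Set.mem_union, Set.mem_ofPred_eq, not_or, not_le, not_lt] at hbad
      exact ENNReal.ofReal_le_ofReal (sum_max_vcgPayment_le_card hM hz hv hW hopt
        (fun i hi => by rw [rivalReserve, if_neg hi]) hbad.1 hbad.2)
  refine (lintegral_mono_ae hbound).trans_eq ?_
  rw [lintegral_add_left measurable_const, lintegral_indicator
    (measurableSet_rivalBadSet z k b M)]
  simp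

theorem eagerRevenue_rival_le (hb : 0 ≤ b) (hc : 0 < c) (hM : 1 ≤ M) {w : (ι → ℝ) → Finset ι}
    (hw : IsEagerRule (rivalFamily z k) (rivalReserve z b) w) :
    eagerRevenue (rivalFamily z k) (rivalMeasure z b c M) (rivalReserve z b) w ≤
      k + ENNReal.ofReal (b + k * M) *
        Measure.pi (rivalMeasure z b c M) (rivalBadSet z k b M) := by
  refine lintegral_rival_le hb hc hM fun v hz hv => ?_
  -- All values meet their reserves here, so eager screening removes nobody.
  have hfam : eagerFamily (rivalFamily z k) (rivalReserve z b) v = rivalFamily z k := by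
    refine Finset.filter_true_of_mem fun S _ i _ => ?_
    rw [rivalReserve]
    split_ifs with hi
    · rw [hi, hz]
    · exact (hv i hi).1
  have hmem := hw.mem v
  have hopt := hw.optimal v
  rw [hfam] at hmem hopt ⊢
  exact ⟨w v, hmem, hopt, le_rfl⟩

theorem lazyRevenue_rival_le (hb : 0 ≤ b) (hc : 0 < c) (hM : 1 ≤ M) {w : (ι → ℝ) → Finset ι}
    (hw : IsLazyRule (rivalFamily z k) w) :
    lazyRevenue (rivalFamily z k) (rivalMeasure z b c M) (rivalReserve z b) w ≤
      k + ENNReal.ofReal (b + k * M) *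
        Measure.pi (rivalMeasure z b c M) (rivalBadSet z k b M) :=
  lintegral_rival_le hb hc hM fun v _ _ => ⟨w v, hw.mem v, hw.optimal v,
    Finset.sum_le_sum_of_subset (Finset.filter_subset _ _)⟩

theorem optimalWelfare_rival_lt_top (hb : 0 ≤ b) (hc : 0 < c) (hM : 1 ≤ M) :
    optimalWelfare (rivalFamily z k) (rivalMeasure z b c M) < ⊤ := by
  have := isProbabilityMeasure_rivalMeasure z b hc M
  refine lt_of_le_of_lt (lintegral_mono_ae (g := fun _ => ENNReal.ofReal (b + k * M)) ?_) ?_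
  · filter_upwards [ae_rivalMeasure z b hc hM] with v ⟨hz, hv⟩
    exact ENNReal.ofReal_le_ofReal (maxWelfare_le (isDownwardClosed_rivalFamily z k).1
      fun S hS => welfare_rivalFamily_le hb hM hz hv hS)
  · simp

end Game

/-! ### Concentration and the limit of many small buyers -/

section Concentration

variable {ι : Type*} [Fintype ι] [DecidableEq ι] {z : ι} {b c M : ℝ}

/-- Each of the `N` independent terms has range in `[0, M]`, hence variance at most `(M / 2) ^ 2`;
the large buyer is given the zero function. -/
theorem rivalMeasure_chebyshev (z : ι) (b : ℝ) (hc : 0 < c) (M : ℝ) {g : ℝ → ℝ}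
    (hg : Measurable g) (hbd : ∀ᵐ x ∂(truncExp c M), g x ∈ Set.Icc 0 M) {N : ℕ}
    (hN : (Finset.univ.erase z).card = N) {d : ℝ} (hd : 0 < d) :
    Measure.pi (rivalMeasure z b c M)
      {v | d ≤ |∑ i ∈ Finset.univ.erase z, g (v i) - N * ∫ x, g x ∂(truncExp c M)|} ≤
      ENNReal.ofReal (N * (M / 2) ^ 2 / d ^ 2) := by
  have := isProbabilityMeasure_rivalMeasure z b hc M
  have hD := isProbabilityMeasure_truncExp hc M
  let Y : ι → ℝ → ℝ := fun i => if i = z then 0 else g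
  have hgL : MemLp g 2 (truncExp c M) := memLp_of_bounded hbd hg.aestronglyMeasurable 2
  have hY : ∀ i, MemLp (Y i) 2 (rivalMeasure z b c M i) := fun i => by
    by_cases hi : i = z
    · simp only [Y, if_pos hi]
      exact MemLp.zero
    · simpa only [Y, rivalMeasure, if_neg hi] using hgL
  have hYv : ∀ i, MemLp (fun v : ι → ℝ => Y i (v i)) 2 (Measure.pi (rivalMeasure z b c M)) :=
    fun i => (hY i).comp_measurePreserving (measurePreserving_eval _ i)
  have hsum : ∀ v : ι → ℝ, (∑ i, fun v : ι → ℝ => Y i (v i)) v =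
      ∑ i ∈ Finset.univ.erase z, g (v i) := fun v => by
    rw [Finset.sum_apply, ← Finset.add_sum_erase _ _ (Finset.mem_univ z)]
    simp only [Y, if_true, Pi.zero_apply, zero_add]
    exact Finset.sum_congr rfl fun i hi => by rw [if_neg (Finset.ne_of_mem_erase hi)]
  have hcomp : ∀ i, ∫ v : ι → ℝ, Y i (v i) ∂(Measure.pi (rivalMeasure z b c M)) =
      if i = z then 0 else ∫ x, g x ∂(truncExp c M) := fun i => by
    rw [integral_comp_eval (hY i).aestronglyMeasurable]
    by_cases hi : i = z <;> simp [Y, rivalMeasure, hi]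
  have hmean : ∫ v, (∑ i, fun v : ι → ℝ => Y i (v i)) v ∂(Measure.pi (rivalMeasure z b c M)) =
      N * ∫ x, g x ∂(truncExp c M) := by
    simp only [Finset.sum_apply]
    rw [integral_finsetSum _ fun i _ => (hYv i).integrable one_le_two]
    simp only [hcomp]
    rw [← Finset.add_sum_erase _ _ (Finset.mem_univ z), if_pos rfl, zero_add,
      Finset.sum_congr rfl fun i hi => if_neg (Finset.ne_of_mem_erase hi), Finset.sum_const, hN,
      nsmul_eq_mul]
  have hvar : variance (∑ i, fun v : ι → ℝ => Y i (v i)) (Measure.pi (rivalMeasure z b c M)) ≤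
      N * (M / 2) ^ 2 := by
    rw [variance_sum_pi hY, ← Finset.add_sum_erase _ _ (Finset.mem_univ z)]
    simp only [Y, if_true, variance_zero, zero_add]
    refine (Finset.sum_le_card_nsmul _ _ ((M / 2) ^ 2) fun i hi => ?_).trans_eq ?_
    · rw [if_neg (Finset.ne_of_mem_erase hi), rivalMeasure, if_neg (Finset.ne_of_mem_erase hi)]
      simpa using variance_le_sq_of_bounded hbd hg.aemeasurable
    · rw [hN, nsmul_eq_mul]
  have h := meas_ge_le_variance_div_sq (memLp_finsetSum' Finset.univ fun i _ => hYv i) hd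
  rw [hmean] at h
  simp only [hsum] at h
  exact h.trans (ENNReal.ofReal_le_ofReal (by gcongr))

theorem integral_indicator_truncExp (hc : 0 < c) (hM : 1 < M) :
    ∫ x, (if 1 < x then (1 : ℝ) else 0) ∂(truncExp c M) = Real.exp (-c) := by
  have h1 : (fun x : ℝ => if 1 < x then (1 : ℝ) else 0) = (Set.Ioi 1).indicator 1 := by
    ext x
    simp [Set.indicator_apply]
  rw [h1, integral_indicator_one measurableSet_Ioi, real_Ioi_truncExp hc le_rfl hM, mul_one]

theorem integral_above_truncExp (hc : 0 < c) (hM : 1 < M)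
    (h0 : 0 ≤ Real.exp (-c) * (1 + 1 / c) - Real.exp (-(c * M)) / c) :
    ∫ x, (if 1 < x then x else 0) ∂(truncExp c M) =
      Real.exp (-c) * (1 + 1 / c) - Real.exp (-(c * M)) / c := by
  have hm : Measurable fun x : ℝ => if 1 < x then x else 0 :=
    Measurable.ite measurableSet_Ioi measurable_id measurable_const
  rw [integral_eq_lintegral_of_nonneg_ae (ae_of_all _ fun x => ?_) hm.aestronglyMeasurable]
  · rw [← ENNReal.toReal_ofReal h0, ← lintegral_Ioi_one_truncExp hc hM,
      ← lintegral_indicator measurableSet_Ioi]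
    congr 1
    refine lintegral_congr fun x => ?_
    by_cases hx : 1 < x <;> simp [hx]
  · simp only [Pi.zero_apply]
    split_ifs with hx <;> linarith

/-- The bad profiles are unlikely. -/
theorem measure_rivalBadSet_le (hc : 0 < c) (hM : 1 < M) {N k : ℕ}
    (hN : (Finset.univ.erase z).card = N) {q m δ : ℝ} (hq : q = Real.exp (-c))
    (hm : m = Real.exp (-c) * (1 + 1 / c) - Real.exp (-(c * M)) / c) (hm0 : 0 ≤ m)
    (hd : 0 < N * δ) (hk : N * (q + δ) ≤ k) (hb : b + M ≤ N * (m - δ)) :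
    Measure.pi (rivalMeasure z b c M) (rivalBadSet z k b M) ≤
      ENNReal.ofReal (2 * (N * (M / 2) ^ 2 / (N * δ) ^ 2)) := by
  have hI := ae_truncExp_mem_Icc c hM.le
  have h1 := rivalMeasure_chebyshev z b hc M (g := fun x => if 1 < x then 1 else 0)
    (Measurable.ite measurableSet_Ioi measurable_const measurable_const)
    (hI.mono fun x _ => by
      split_ifs
      · exact ⟨zero_le_one, hM.le⟩
      · exact ⟨le_rfl, by linarith⟩) hN hd
  have h2 := rivalMeasure_chebyshev z b hc M (g := fun x => if 1 < x then x else 0)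
    (Measurable.ite measurableSet_Ioi measurable_id measurable_const)
    (hI.mono fun x hx => by
      split_ifs
      · exact ⟨zero_le_one.trans hx.1, hx.2⟩
      · exact ⟨le_rfl, by linarith⟩) hN hd
  rw [integral_indicator_truncExp hc hM, ← hq] at h1
  rw [integral_above_truncExp hc hM (hm ▸ hm0), ← hm] at h2
  have hnn : 0 ≤ N * (M / 2) ^ 2 / (N * δ) ^ 2 := by positivity
  rw [two_mul, ENNReal.ofReal_add hnn hnn]
  refine (measure_union_le _ _).trans (add_le_add ((measure_mono fun v hv => ?_).trans h1)
    ((measure_mono fun v hv => ?_).trans h2))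
  · simp only [Set.mem_ofPred_eq] at hv ⊢
    refine le_trans ?_ (le_abs_self _)
    rw [← Finset.sum_filter, Finset.sum_const, nsmul_eq_mul, mul_one]
    have : (k : ℝ) ≤ (((Finset.univ.erase z).filter fun i => 1 < v i).card : ℝ) := by
      exact_mod_cast hv
    linarith
  · simp only [Set.mem_ofPred_eq] at hv ⊢
    refine le_trans ?_ (neg_le_abs _)
    rw [← Finset.sum_filter]
    linarith

end Concentration

/-- Parameters of the small buyers for which revenue and welfare are in the ratio `e + 1`, up to an
arbitrarily small error. -/
theorem exists_truncExp_parameters {κ : ℝ} (hκ : 1 / (Real.exp 1 + 1) < κ) :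
    ∃ c M δ : ℝ, Real.exp (-1) < c ∧ 1 < M ∧ 0 < δ ∧
      0 < Real.exp (-c) * (1 + 1 / c) - Real.exp (-(c * M)) / c - 2 * δ ∧
      Real.exp (-c) + δ <
        κ * (Real.exp (-c) * (1 + 1 / c) - Real.exp (-(c * M)) / c - 2 * δ) := by
  -- One parameter `x → ∞` drives everything: `c = 1 / e + 1 / x`, `M = x`, `δ = 1 / x`. In the
  -- limit the mean above `1` is `exp (-1 / e) * (1 + e)`, which is `e + 1` times the probability of
  -- exceeding `1`.
  have hδ : Filter.Tendsto (fun x : ℝ => x⁻¹) Filter.atTop (nhds 0) := tendsto_inv_atTop_zero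
  have hc : Filter.Tendsto (fun x : ℝ => Real.exp (-1) + x⁻¹) Filter.atTop
      (nhds (Real.exp (-1))) := by
    simpa using hδ.const_add (Real.exp (-1))
  have he : Real.exp (-1) ≠ 0 := (Real.exp_pos _).ne'
  have hq : Filter.Tendsto (fun x : ℝ => Real.exp (-(Real.exp (-1) + x⁻¹))) Filter.atTop
      (nhds (Real.exp (-Real.exp (-1)))) :=
    (Real.continuous_exp.tendsto _).comp hc.neg
  have htail : Filter.Tendsto (fun x : ℝ => Real.exp (-((Real.exp (-1) + x⁻¹) * x)))
      Filter.atTop (nhds 0) := by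
    refine Real.tendsto_exp_neg_atTop_nhds_zero.comp
      (Filter.Tendsto.pos_mul_atTop (Real.exp_pos (-1)) hc Filter.tendsto_id)
  have hm : Filter.Tendsto (fun x : ℝ => Real.exp (-(Real.exp (-1) + x⁻¹)) *
      (1 + 1 / (Real.exp (-1) + x⁻¹)) -
      Real.exp (-((Real.exp (-1) + x⁻¹) * x)) / (Real.exp (-1) + x⁻¹) - 2 * x⁻¹) Filter.atTop
      (nhds (Real.exp (-Real.exp (-1)) * (1 + 1 / Real.exp (-1)) - 0 / Real.exp (-1) - 2 * 0)) :=
    ((hq.mul ((tendsto_const_nhds.div hc he).const_add 1)).sub (htail.div hc he)).sub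
      (hδ.const_mul 2)
  have hlim : Real.exp (-Real.exp (-1)) * (1 + 1 / Real.exp (-1)) - 0 / Real.exp (-1) - 2 * 0 =
      Real.exp (-Real.exp (-1)) * (Real.exp 1 + 1) := by
    rw [zero_div, Real.exp_neg 1, one_div, inv_inv]
    ring
  rw [hlim] at hm
  have hpos : 0 < Real.exp (-Real.exp (-1)) * (Real.exp 1 + 1) := by positivity
  have hlt : Real.exp (-Real.exp (-1)) + 0 <
      κ * (Real.exp (-Real.exp (-1)) * (Real.exp 1 + 1)) := by
    have h1 : (1 : ℝ) < κ * (Real.exp 1 + 1) := (div_lt_iff₀ (by positivity)).1 hκ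
    have h2 := mul_lt_mul_of_pos_left h1 (Real.exp_pos (-Real.exp (-1)))
    linarith
  obtain ⟨x, hx1, hx2, hx3⟩ := ((Filter.eventually_gt_atTop (1 : ℝ)).and
    ((hm.eventually_const_lt hpos).and
      ((hq.add hδ).eventually_lt (hm.const_mul κ) hlt))).exists
  have hx0 : 0 < x⁻¹ := inv_pos.2 (zero_lt_one.trans hx1)
  exact ⟨Real.exp (-1) + x⁻¹, x, x⁻¹, by linarith, hx1, hx0, hx2, hx3⟩

/-- With many small buyers, the expected revenue of the auction is close to `N * (q + δ)`. -/
theorem exists_rival_size {κ q m δ M : ℝ} (hq : 0 < q) (hδ : 0 < δ) (hM : 1 < M)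
    (hm : 0 < m - 2 * δ) (h : q + δ < κ * (m - 2 * δ)) :
    ∃ N k : ℕ, 0 < N ∧ N * (q + δ) ≤ k ∧ N * (m - 2 * δ) + M ≤ N * (m - δ) ∧
      k + (N * (m - 2 * δ) + k * M) * (2 * (N * (M / 2) ^ 2 / (N * δ) ^ 2)) ≤
        κ * (N * (m - 2 * δ)) := by
  -- `C` bounds the contribution of the bad profiles uniformly in `N`: revenue there is of order
  -- `N`, but their probability is of order `1 / N`. A large `N` makes the linear gap absorb `C` and
  -- the rounding of `k`, and makes `N * δ` exceed the margin `M`.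
  set C : ℝ := (m - 2 * δ + (q + δ + 1) * M) * (M ^ 2 / (2 * δ ^ 2)) with hC
  have hgap : 0 < κ * (m - 2 * δ) - (q + δ) := by linarith
  obtain ⟨N, hN⟩ := exists_nat_gt (max 1 (max (M / δ) ((1 + C) / (κ * (m - 2 * δ) - (q + δ)))))
  obtain ⟨hN1, hN⟩ := max_lt_iff.1 hN
  obtain ⟨hN2, hN3⟩ := max_lt_iff.1 hN
  rw [div_lt_iff₀ hδ] at hN2
  rw [div_lt_iff₀ hgap] at hN3
  have hN0 : (0 : ℝ) < N := by linarith
  refine ⟨N, ⌈N * (q + δ)⌉₊, by exact_mod_cast hN0, Nat.le_ceil _, by linarith, ?_⟩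
  have hk : (⌈N * (q + δ)⌉₊ : ℝ) ≤ N * (q + δ) + 1 :=
    (Nat.ceil_lt_add_one (by positivity)).le
  have hk' : (⌈N * (q + δ)⌉₊ : ℝ) ≤ N * (q + δ + 1) := by linarith
  have h1 : (N * (m - 2 * δ) + (⌈N * (q + δ)⌉₊ : ℝ) * M) *
      (2 * (N * (M / 2) ^ 2 / (N * δ) ^ 2)) ≤ C := by
    calc _ ≤ (N * (m - 2 * δ) + N * (q + δ + 1) * M) * (2 * (N * (M / 2) ^ 2 / (N * δ) ^ 2)) := by
          gcongr
      _ = C := by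
          rw [hC]
          field_simp
  linarith

/-- The constant `1 / (e + 1)` cannot be improved. -/
theorem exists_rival_tight {ε : ℝ} (hε : 0 < ε) :
    ∃ (n : ℕ) (X : Finset (Finset (Fin n))) (μ : Fin n → Measure ℝ) (r : Fin n → ℝ),
      IsDownwardClosed X ∧
      (∀ i, IsProbabilityMeasure (μ i)) ∧ (∀ i, IsQuasiMHR (μ i)) ∧
      (∀ i p, IsMonopolyReserve (μ i) p ↔ p = r i) ∧
      0 < optimalRevenue X μ ∧ optimalWelfare X μ < ⊤ ∧
      (∀ w, IsEagerRule X r w →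
        eagerRevenue X μ r w ≤
          ENNReal.ofReal (1 / (Real.exp 1 + 1) + ε) * optimalRevenue X μ) ∧
      (∀ w, IsLazyRule X w →
        lazyRevenue X μ r w ≤
          ENNReal.ofReal (1 / (Real.exp 1 + 1) + ε) * optimalRevenue X μ ∧
        lazyRevenue X μ r w ≤
          ENNReal.ofReal (1 / (Real.exp 1 + 1) + ε) * optimalWelfare X μ) := by
  set κ := 1 / (Real.exp 1 + 1) + ε with hκ
  obtain ⟨c, M, δ, hc, hM, hδ, hm, hlt⟩ := exists_truncExp_parameters (κ := κ) (by linarith)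
  set m := Real.exp (-c) * (1 + 1 / c) - Real.exp (-(c * M)) / c with hmdef
  obtain ⟨N, k, hN, hk, hb, hrev⟩ := exists_rival_size (Real.exp_pos (-c)) hδ hM hm hlt
  have hNR : (0 : ℝ) < N := by exact_mod_cast hN
  have hc0 : 0 < c := (Real.exp_pos _).trans hc
  set b : ℝ := N * (m - 2 * δ) with hbdef
  have hb0 : 0 < b := by positivity
  have hκ0 : 0 ≤ κ := by positivity
  let z : Fin (N + 1) := 0
  have hcard : (Finset.univ.erase z).card = N := by simp
  have hprob := isProbabilityMeasure_rivalMeasure z b hc0 M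
  have hX := isDownwardClosed_rivalFamily z k
  have hMHR := isQuasiMHR_rivalMeasure z hb0.le hc0 hM.le
  have hres := isMonopolyReserve_rivalMeasure_iff (M := M) z hb0 hc
  have hopt : ENNReal.ofReal b ≤ optimalRevenue (rivalFamily z k) (rivalMeasure z b c M) :=
    ofReal_le_optimalRevenue_rivalFamily z k hb0.le hc0
  have hwel : optimalRevenue (rivalFamily z k) (rivalMeasure z b c M) ≤
      optimalWelfare (rivalFamily z k) (rivalMeasure z b c M) :=
    optimalRevenue_le_optimalWelfare hX (fun i => (hMHR i).nonneg)
      (fun i => (hres i (rivalReserve z b i)).2 rfl)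
  have hbad := measure_rivalBadSet_le (z := z) (b := b) (k := k) hc0 hM hcard rfl hmdef
    (by linarith) (by positivity : 0 < N * δ) hk hb
  have hmain : k + ENNReal.ofReal (b + k * M) *
      Measure.pi (rivalMeasure z b c M) (rivalBadSet z k b M) ≤
      ENNReal.ofReal κ * optimalRevenue (rivalFamily z k) (rivalMeasure z b c M) := by
    refine le_trans ?_ (mul_le_mul_right hopt _)
    refine (add_le_add_right (mul_le_mul_right hbad _) _).trans ?_
    rw [← ENNReal.ofReal_mul (by positivity), ← ENNReal.ofReal_natCast,
      ← ENNReal.ofReal_add (by positivity) (by positivity), ← ENNReal.ofReal_mul hκ0]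
    exact ENNReal.ofReal_le_ofReal hrev
  refine ⟨N + 1, rivalFamily z k, rivalMeasure z b c M, rivalReserve z b, hX, hprob, hMHR, hres,
    (ENNReal.ofReal_pos.2 hb0).trans_le hopt, optimalWelfare_rival_lt_top hb0.le hc0 hM.le,
    fun w hw => (eagerRevenue_rival_le hb0.le hc0 hM.le hw).trans hmain, fun w hw => ?_⟩
  have hlazy := (lazyRevenue_rival_le hb0.le hc0 hM.le hw).trans hmain
  exact ⟨hlazy, hlazy.trans (mul_le_mul_right hwel _)⟩

end MonopolyReserves

end

open MonopolyReserves in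
theorem mainTheorem6 :
    (∀ (n : ℕ) (X : Finset (Finset (Fin n))) (μ : Fin n → Measure ℝ) (r : Fin n → ℝ),
      IsDownwardClosed X →
      (∀ i, IsProbabilityMeasure (μ i)) → (∀ i, IsQuasiMHR (μ i)) →
      (∀ i, IsMonopolyReserve (μ i) (r i)) →
        (∀ w, IsEagerRule X r w →
          ENNReal.ofReal (1 / (Real.exp 1 + 1)) * optimalRevenue X μ ≤ eagerRevenue X μ r w) ∧
        (∀ w, IsLazyRule X w →
          ENNReal.ofReal (1 / (Real.exp 1 + 1)) * optimalRevenue X μ ≤ lazyRevenue X μ r w ∧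
          ENNReal.ofReal (1 / (Real.exp 1 + 1)) * optimalWelfare X μ ≤ lazyRevenue X μ r w)) ∧
    (∀ ε : ℝ, 0 < ε →
      ∃ (n : ℕ) (X : Finset (Finset (Fin n))) (μ : Fin n → Measure ℝ) (r : Fin n → ℝ),
        IsDownwardClosed X ∧
        (∀ i, IsProbabilityMeasure (μ i)) ∧ (∀ i, IsQuasiMHR (μ i)) ∧
        (∀ i p, IsMonopolyReserve (μ i) p ↔ p = r i) ∧
        0 < optimalRevenue X μ ∧ optimalWelfare X μ < ⊤ ∧
        (∀ w, IsEagerRule X r w →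
          eagerRevenue X μ r w ≤
            ENNReal.ofReal (1 / (Real.exp 1 + 1) + ε) * optimalRevenue X μ) ∧
        (∀ w, IsLazyRule X w →
          lazyRevenue X μ r w ≤
            ENNReal.ofReal (1 / (Real.exp 1 + 1) + ε) * optimalRevenue X μ ∧
          lazyRevenue X μ r w ≤
            ENNReal.ofReal (1 / (Real.exp 1 + 1) + ε) * optimalWelfare X μ)) :=
  ⟨fun _ _ _ _ hX _ hμ hr =>
    have hOW := optimalRevenue_le_optimalWelfare hX (fun i => (hμ i).nonneg) hr
    ⟨fun _ hw => optimalRevenue_le_eagerRevenue hX hμ hr hw, fun _ hw =>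
      ⟨(mul_le_mul_right hOW _).trans (optimalWelfare_le_lazyRevenue hX hμ hr hw),
        optimalWelfare_le_lazyRevenue hX hμ hr hw⟩⟩,
    fun _ hε => exists_rival_tight hε⟩
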